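/- Let $\mathbb{T}=\mathbb{R}/2\pi\mathbb{Z}$ be the circle with the arc-length distance $\mathrm{dist}$ and the normalized arc-length measure $dm$, and write $\widehat f(n)=\int_{\mathbb{T}} f(t)e^{-int}\,dm(t)$ for $n\in\mathbb{Z}$. Let $(\lambda_n)_{n\ge 0}$ be positive real numbers such that (i) $\sum_{n} \frac{1}{\lambda_n}=+\infty$, and (ii) there is a constant $C>1$ such that $C^{-1}\lambda_n\le \lambda_k\le C\lambda_n$ for all $n\ge 1$ and all $n\le k\le 2n$. Let $\mathscr{C}$ be the collection of non-empty compact subsets of $\mathbb{T}$ with the Hausdorff metric $$d_{\mathscr{C}}(E,K)=\sup_{x\in E}\mathrm{dist}(x,K)+\sup_{y\in K}\mathrm{dist}(y,E).$$ Let $\mathcal{L}_{\mathscr{C}}(\lambda)$ be the set of pairs $(f,E)$ with $f\in L^\infty(\mathbb{T},dm)$ and $E\in\mathscr{C}$ such that $0\le f\le 2$ $dm$-almost everywhere, the closed support of the measure $f\,dm$ is contained in $E$, and $\sum_{n\in\mathbb{Z}}|\widehat f(n)|^2\lambda_{|n|}<\infty$. Put $$d_\lambda\big((f,E),(g,K)\big)=d_{\mathscr{C}}(E,K)+\Big(\sum_{n\in\mathbb{Z}}|\widehat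 f(n)-\widehat g(n)|^2\lambda_{|n|}\Big)^{1/2}.$$ Then $d_\lambda$ is a metric on $\mathcal{L}_{\mathscr{C}}(\lambda)$, the metric space $(\mathcal{L}_{\mathscr{C}}(\lambda),d_\lambda)$ is complete, and the set of pairs $(f,E)\in\mathcal{L}_{\mathscr{C}}(\lambda)$ for which $E$ has empty interior is a dense $G_\delta$ subset of it (so that it is generic in the sense of Baire category). -/

import Mathlib

open MeasureTheory

noncomputable section

/-- The circle, as `ℝ / 2πℤ`, with the arc-length distance. -/
abbrev Torus : Type := AddCircle (2 * Real.pi)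

instance fact_zero_lt_two_mul_pi : Fact (0 < 2 * Real.pi) := ⟨Real.two_pi_pos⟩

/-- Normalized arc-length measure on the circle. -/
abbrev torusMeasure : Measure Torus := AddCircle.haarAddCircle

/-- Real-valued essentially bounded functions on the circle, modulo a.e. equality. -/
abbrev TorusLinfty : Type := Lp ℝ ⊤ torusMeasure

/-- The `n`-th Fourier coefficient `∫ f(t) e^{-int} dm(t)`. -/
def torusFourier (f : TorusLinfty) (n : ℤ) : ℂ :=
  fourierCoeff (fun t : Torus => ((f t : ℝ) : ℂ)) n

/-- The terms `|f̂(n)|² λ_{|n|}` of the weighted sum. -/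
def weightedTerm (lam : ℕ → ℝ) (f : TorusLinfty) (n : ℤ) : ℝ :=
  ‖torusFourier f n‖ ^ 2 * lam n.natAbs

/-- `(f̂(n))_n` belongs to `ℓ²(λ)`. -/
def MemWeightedL2 (lam : ℕ → ℝ) (f : TorusLinfty) : Prop :=
  Summable (weightedTerm lam f)

/-- The norm of `ℓ²(λ)`, for elements of `ℓ²(λ)`. -/
def weightedNorm (lam : ℕ → ℝ) (f : TorusLinfty) : ℝ :=
  Real.sqrt (∑' n : ℤ, weightedTerm lam f n)

/-- The closed (essential) support of `f`, that is, the support of the measure `|f| dm`. -/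
def essentialSupport (f : TorusLinfty) : Set Torus :=
  (torusMeasure.withDensity fun t => ‖f t‖ₑ).support

/-- The Hausdorff metric on non-empty compact subsets of the circle, as a sum of two suprema. -/
def hausdorffSum (E K : TopologicalSpace.NonemptyCompacts Torus) : ℝ :=
  sSup ((fun x => Metric.infDist x (K : Set Torus)) '' (E : Set Torus)) +
    sSup ((fun x => Metric.infDist x (E : Set Torus)) '' (K : Set Torus))

/-- The pairs `(f, E)` with `0 ≤ f ≤ 2` a.e., `supp f ⊆ E`, and `(f̂(n))_n ∈ ℓ²(λ)`. -/
@[ext]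
structure SupportPair (lam : ℕ → ℝ) where
  f : TorusLinfty
  E : TopologicalSpace.NonemptyCompacts Torus
  bounds : ∀ᵐ t ∂torusMeasure, 0 ≤ f t ∧ f t ≤ 2
  support_subset : essentialSupport f ⊆ (E : Set Torus)
  mem_weighted : MemWeightedL2 lam f

/-- `d_λ((f, E), (g, K))`: Hausdorff distance of `E, K` plus the `ℓ²(λ)`-norm of `f - g`. -/
def pairDist {lam : ℕ → ℝ} (p q : SupportPair lam) : ℝ :=
  hausdorffSum p.E q.E + weightedNorm lam (p.f - q.f)

theorem torusFourier_sub (f g : TorusLinfty) (n : ℤ) :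
    torusFourier (f - g) n = torusFourier f n - torusFourier g n := by
  have hi : ∀ h : TorusLinfty, Integrable (fun t : Torus => fourier (-n) t • ((h t : ℝ) : ℂ))
      torusMeasure := by
    intro h
    have h1 : Integrable (fun t : Torus => ((h t : ℝ) : ℂ)) torusMeasure :=
      ((Lp.memLp h).integrable le_top).ofReal
    refine h1.bdd_mul (c := 1) (by fun_prop) ?_
    filter_upwards with t
    rw [fourier_apply]
    exact (Circle.norm_coe _).le
  unfold torusFourier fourierCoeff
  rw [← integral_sub (hi f) (hi g)]
  refine integral_congr_ae ?_
  filter_upwards [Lp.coeFn_sub f g] with t ht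
  rw [ht, Pi.sub_apply, Complex.ofReal_sub, smul_sub]

/-- `ℓ²(λ)` is closed under differences, so `weightedNorm lam (p.f - q.f)` is a genuine sum. -/
theorem MemWeightedL2.sub {lam : ℕ → ℝ} (hlam : ∀ n, 0 < lam n) {f g : TorusLinfty}
    (hf : MemWeightedL2 lam f) (hg : MemWeightedL2 lam g) : MemWeightedL2 lam (f - g) := by
  refine Summable.of_nonneg_of_le (fun n => ?_) (fun n => ?_) ((hf.mul_left 2).add (hg.mul_left 2))
  · exact mul_nonneg (sq_nonneg _) (hlam _).le
  · unfold weightedTerm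
    rw [torusFourier_sub]
    have h1 := norm_sub_le (torusFourier f n) (torusFourier g n)
    have h2 : ‖torusFourier f n - torusFourier g n‖ ^ 2 ≤
        2 * ‖torusFourier f n‖ ^ 2 + 2 * ‖torusFourier g n‖ ^ 2 := by
      nlinarith [norm_nonneg (torusFourier f n - torusFourier g n),
        sq_nonneg (‖torusFourier f n‖ - ‖torusFourier g n‖)]
    nlinarith [mul_le_mul_of_nonneg_right h2 (hlam n.natAbs).le]

end

/-!
The metric is the sum of a metric equivalent to the Hausdorff distance and of the distance of the
sequences `λ_{|n|}^{1/2} f̂(n)` in the Hilbert space `ℓ²`. Completeness follows from completeness of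
these two spaces: functions with values in `[0, 2]` are bounded in `L²`, so convergence of each
Fourier coefficient implies weak convergence, and weak limits inherit both the bounds and the
support condition (`exists_limit_of_tendsto_torusFourier`, `essentialSupport_subset_of_tendsto`).

The sets with empty interior are those which contain no member of a countable basis, and not to
contain a given set is an open condition on `E`. By the Baire category theorem it is enough to
show, for a single non-empty open set `U`, that the pairs with `U ⊄ E` are dense
(`exists_pair_near_not_subset`).

To make `x ∈ U` an isolated point of `E`, `f` is first made smooth by a convolution
which enlarges `E` slightly (`exists_smooth_pair_near`), and then replaced by
`f (1 - h(· - x)) / (1 + δ)`, where `h = 1` near `0`, `-δ ≤ h ≤ 1`, and `h` is small in `ℓ²(λ)`;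
multiplication by a smooth function is bounded on `ℓ²(λ)` because the weights grow at most
polynomially (`exists_sum_weighted_convolution_le`).

The existence of `h` (`exists_small_cutoff`) is where `∑ 1 / λ_n = ∞` is used. As the weights need
not be monotone, low frequencies may be expensive. Hence `h` is built from a bump `u` with many
vanishing moments, `u = 1` near `0` and `-δ ≤ u ≤ 1` (`exists_cutoff`): the dilates `u(2^j ·)` are
concentrated at frequencies of order `2^j`, they are almost orthogonal in `ℓ²(λ)`, and their
squared norms there are of order `2^{-j} λ_{2^j}` (`sum_weighted_sq_dyadic_le`). The average
`h = S⁻¹ ∑_{j < J} (2^j / λ_{2^j}) u(2^j ·)` with `S = ∑_{j < J} 2^j / λ_{2^j}` then has squared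
norm `O(1 / S)`, and `S → ∞` by condensation (`exists_le_sum_condensed`).
-/

open MeasureTheory

noncomputable section

/-! ### The Hausdorff distance as a sum of two excesses -/

/-- The excess `sup_{x ∈ E} dist(x, K)` of `E` over `K`. -/
def hausdorffExcess (E K : TopologicalSpace.NonemptyCompacts Torus) : ℝ :=
  sSup ((fun x => Metric.infDist x (K : Set Torus)) '' (E : Set Torus))

theorem hausdorffSum_eq (E K : TopologicalSpace.NonemptyCompacts Torus) :
    hausdorffSum E K = hausdorffExcess E K + hausdorffExcess K E := rfl

theorem infDist_le_dist {E K : TopologicalSpace.NonemptyCompacts Torus} {x : Torus}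
    (hx : x ∈ (E : Set Torus)) : Metric.infDist x (K : Set Torus) ≤ dist E K := by
  rw [Metric.NonemptyCompacts.dist_eq]
  exact Metric.infDist_le_hausdorffDist_of_mem hx
    (Metric.hausdorffEDist_ne_top_of_nonempty_of_bounded E.nonempty K.nonempty
      E.isCompact.isBounded K.isCompact.isBounded)

theorem infDist_le_hausdorffExcess {E K : TopologicalSpace.NonemptyCompacts Torus} {x : Torus}
    (hx : x ∈ (E : Set Torus)) : Metric.infDist x (K : Set Torus) ≤ hausdorffExcess E K := by
  refine le_csSup ⟨dist E K, ?_⟩ ⟨x, hx, rfl⟩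
  rintro _ ⟨y, hy, rfl⟩
  exact infDist_le_dist hy

theorem hausdorffExcess_le {E K : TopologicalSpace.NonemptyCompacts Torus} {r : ℝ}
    (h : ∀ x ∈ (E : Set Torus), Metric.infDist x (K : Set Torus) ≤ r) :
    hausdorffExcess E K ≤ r := by
  refine csSup_le (E.nonempty.image _) ?_
  rintro _ ⟨y, hy, rfl⟩
  exact h y hy

theorem hausdorffExcess_nonneg (E K : TopologicalSpace.NonemptyCompacts Torus) :
    0 ≤ hausdorffExcess E K := by
  obtain ⟨x, hx⟩ := E.nonempty
  exact Metric.infDist_nonneg.trans (infDist_le_hausdorffExcess hx)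

theorem hausdorffExcess_triangle (E K G : TopologicalSpace.NonemptyCompacts Torus) :
    hausdorffExcess E G ≤ hausdorffExcess E K + hausdorffExcess K G := by
  refine hausdorffExcess_le fun x hx => ?_
  obtain ⟨y, hy, hxy⟩ := K.isCompact.exists_infDist_eq_dist K.nonempty x
  calc Metric.infDist x (G : Set Torus) ≤ Metric.infDist y (G : Set Torus) + dist x y :=
        Metric.infDist_le_infDist_add_dist
    _ ≤ hausdorffExcess K G + hausdorffExcess E K := by
        rw [← hxy]
        exact add_le_add (infDist_le_hausdorffExcess hy) (infDist_le_hausdorffExcess hx)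
    _ = _ := add_comm _ _

theorem dist_le_hausdorffSum (E K : TopologicalSpace.NonemptyCompacts Torus) :
    dist E K ≤ hausdorffSum E K := by
  rw [Metric.NonemptyCompacts.dist_eq, hausdorffSum_eq]
  have h1 := hausdorffExcess_nonneg E K
  have h2 := hausdorffExcess_nonneg K E
  refine Metric.hausdorffDist_le_of_infDist (by linarith) (fun x hx => ?_) (fun x hx => ?_)
  · linarith [infDist_le_hausdorffExcess (K := K) hx]
  · linarith [infDist_le_hausdorffExcess (K := E) hx]

theorem hausdorffSum_le_two_mul_dist (E K : TopologicalSpace.NonemptyCompacts Torus) :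
    hausdorffSum E K ≤ 2 * dist E K := by
  rw [hausdorffSum_eq, two_mul]
  refine add_le_add (hausdorffExcess_le fun x hx => infDist_le_dist hx) ?_
  rw [dist_comm]
  exact hausdorffExcess_le fun x hx => infDist_le_dist hx

theorem hausdorffSum_nonneg (E K : TopologicalSpace.NonemptyCompacts Torus) :
    0 ≤ hausdorffSum E K :=
  add_nonneg (hausdorffExcess_nonneg _ _) (hausdorffExcess_nonneg _ _)

theorem hausdorffSum_self (E : TopologicalSpace.NonemptyCompacts Torus) :
    hausdorffSum E E = 0 :=
  le_antisymm (by simpa using hausdorffSum_le_two_mul_dist E E) (hausdorffSum_nonneg _ _)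

theorem hausdorffSum_comm (E K : TopologicalSpace.NonemptyCompacts Torus) :
    hausdorffSum E K = hausdorffSum K E := add_comm _ _

theorem hausdorffSum_triangle (E K G : TopologicalSpace.NonemptyCompacts Torus) :
    hausdorffSum E G ≤ hausdorffSum E K + hausdorffSum K G := by
  simp only [hausdorffSum_eq]
  linarith [hausdorffExcess_triangle E K G, hausdorffExcess_triangle G K E]

/-! ### Bounded functions as elements of `L²`, and uniqueness of Fourier coefficients -/

theorem TorusLinfty.memLp_two (f : TorusLinfty) :
    MemLp (fun t : Torus => ((f t : ℝ) : ℂ)) 2 torusMeasure :=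
  ((Lp.memLp f).mono_exponent le_top).ofReal

/-- A bounded real function on the circle, as an element of complex `L²`. -/
def TorusLinfty.toL2 (f : TorusLinfty) : Lp ℂ 2 torusMeasure := f.memLp_two.toLp _

theorem TorusLinfty.coeFn_toL2 (f : TorusLinfty) :
    (f.toL2 : Torus → ℂ) =ᵐ[torusMeasure] fun t => ((f t : ℝ) : ℂ) := f.memLp_two.coeFn_toLp

theorem torusFourier_eq_repr (f : TorusLinfty) (n : ℤ) :
    torusFourier f n = fourierBasis.repr f.toL2 n := by
  rw [fourierBasis_repr]
  exact congrFun (fourierCoeff_congr_ae f.coeFn_toL2.symm) n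

theorem torusFourier_injective {f g : TorusLinfty}
    (h : ∀ n, torusFourier f n = torusFourier g n) : f = g := by
  have h1 : f.toL2 = g.toL2 := by
    apply fourierBasis.repr.injective
    ext n
    rw [← torusFourier_eq_repr, ← torusFourier_eq_repr, h]
  refine Lp.ext ?_
  filter_upwards [f.coeFn_toL2, g.coeFn_toL2] with t hf hg
  rw [h1, hg] at hf
  exact_mod_cast hf.symm

/-! ### The metric on pairs -/

/-- The sequence `(λ_{|n|}^{1/2} f̂(n))_n`, whose `ℓ²` norm is the `ℓ²(λ)` norm of `f̂`. -/
def weightedSeq (lam : ℕ → ℝ) (f : TorusLinfty) (n : ℤ) : ℂ :=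
  (Real.sqrt (lam n.natAbs) : ℂ) * torusFourier f n

theorem norm_weightedSeq_sq {lam : ℕ → ℝ} (hpos : ∀ n, 0 < lam n) (f : TorusLinfty) (n : ℤ) :
    ‖weightedSeq lam f n‖ ^ 2 = weightedTerm lam f n := by
  rw [weightedSeq, norm_mul, mul_pow, Complex.norm_real, Real.norm_eq_abs, sq_abs,
    Real.sq_sqrt (hpos _).le, mul_comm]
  rfl

theorem weightedTerm_nonneg {lam : ℕ → ℝ} (hpos : ∀ n, 0 < lam n) (f : TorusLinfty) (n : ℤ) :
    0 ≤ weightedTerm lam f n := mul_nonneg (sq_nonneg _) (hpos _).le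

theorem memWeightedL2_iff_memlp {lam : ℕ → ℝ} (hpos : ∀ n, 0 < lam n) (f : TorusLinfty) :
    MemWeightedL2 lam f ↔ Memℓp (weightedSeq lam f) 2 := by
  rw [memℓp_gen_iff (by norm_num)]
  simp only [ENNReal.toReal_ofNat, Real.rpow_two, norm_weightedSeq_sq hpos]
  rfl

/-- The weighted sequence as an element of the Hilbert space `ℓ²`. -/
def weightedLp {lam : ℕ → ℝ} (hpos : ∀ n, 0 < lam n) (f : TorusLinfty)
    (hf : MemWeightedL2 lam f) : lp (fun _ : ℤ => ℂ) 2 :=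
  ⟨weightedSeq lam f, (memWeightedL2_iff_memlp hpos f).1 hf⟩

theorem norm_weightedLp {lam : ℕ → ℝ} (hpos : ∀ n, 0 < lam n) (f : TorusLinfty)
    (hf : MemWeightedL2 lam f) : ‖weightedLp hpos f hf‖ = weightedNorm lam f := by
  have h := lp.norm_rpow_eq_tsum (p := 2) (by norm_num) (weightedLp hpos f hf)
  simp only [ENNReal.toReal_ofNat, Real.rpow_two] at h
  rw [weightedNorm, ← Real.sqrt_sq (norm_nonneg (weightedLp hpos f hf)), h]
  congr 1
  exact tsum_congr fun n => norm_weightedSeq_sq hpos f n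

theorem weightedLp_sub {lam : ℕ → ℝ} (hpos : ∀ n, 0 < lam n) {f g : TorusLinfty}
    (hf : MemWeightedL2 lam f) (hg : MemWeightedL2 lam g) :
    weightedLp hpos (f - g) (hf.sub hpos hg) = weightedLp hpos f hf - weightedLp hpos g hg := by
  ext n
  simp only [weightedLp, lp.coeFn_sub, Pi.sub_apply, weightedSeq, torusFourier_sub, mul_sub]

theorem weightedNorm_sub {lam : ℕ → ℝ} (hpos : ∀ n, 0 < lam n) {f g : TorusLinfty}
    (hf : MemWeightedL2 lam f) (hg : MemWeightedL2 lam g) :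
    weightedNorm lam (f - g) = dist (weightedLp hpos f hf) (weightedLp hpos g hg) := by
  rw [dist_eq_norm, ← weightedLp_sub, norm_weightedLp]

theorem weightedLp_injective {lam : ℕ → ℝ} (hpos : ∀ n, 0 < lam n) {f g : TorusLinfty}
    (hf : MemWeightedL2 lam f) (hg : MemWeightedL2 lam g)
    (h : weightedLp hpos f hf = weightedLp hpos g hg) : f = g := by
  refine torusFourier_injective fun n => ?_
  have h1 : weightedSeq lam f n = weightedSeq lam g n :=
    congrArg (fun v : lp (fun _ : ℤ => ℂ) 2 => v n) h
  refine mul_left_cancel₀ ?_ h1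
  exact_mod_cast (Real.sqrt_pos.2 (hpos _)).ne'

/-- The distance of pairs is the sum of the Hausdorff distance and of a distance in `ℓ²`. -/
theorem pairDist_eq {lam : ℕ → ℝ} (hpos : ∀ n, 0 < lam n) (p q : SupportPair lam) :
    pairDist p q = hausdorffSum p.E q.E +
      dist (weightedLp hpos p.f p.mem_weighted) (weightedLp hpos q.f q.mem_weighted) := by
  rw [pairDist, weightedNorm_sub hpos p.mem_weighted q.mem_weighted]

/-- The metric space of pairs `(f, E)`. -/
abbrev pairMetricSpace {lam : ℕ → ℝ} (hpos : ∀ n, 0 < lam n) : MetricSpace (SupportPair lam) where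
  dist := pairDist
  dist_self p := by rw [pairDist_eq hpos, hausdorffSum_self, dist_self, add_zero]
  dist_comm p q := by
    rw [pairDist_eq hpos, pairDist_eq hpos, hausdorffSum_comm, dist_comm]
  dist_triangle p q r := by
    rw [pairDist_eq hpos, pairDist_eq hpos, pairDist_eq hpos]
    linarith [hausdorffSum_triangle p.E q.E r.E,
      dist_triangle (weightedLp hpos p.f p.mem_weighted) (weightedLp hpos q.f q.mem_weighted)
        (weightedLp hpos r.f r.mem_weighted)]
  eq_of_dist_eq_zero := by
    intro p q h
    change pairDist p q = 0 at h
    rw [pairDist_eq hpos] at h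
    have h1 := hausdorffSum_nonneg p.E q.E
    have h2 : 0 ≤ dist (weightedLp hpos p.f p.mem_weighted) (weightedLp hpos q.f q.mem_weighted) :=
      dist_nonneg
    refine SupportPair.ext (weightedLp_injective hpos p.mem_weighted q.mem_weighted
      (dist_le_zero.1 (by linarith))) (dist_le_zero.1 ?_)
    linarith [dist_le_hausdorffSum p.E q.E]

/-! ### Weak limits in Hilbert spaces -/

open Filter Topology in
/-- In a Hilbert space, a bounded sequence whose coordinates in a Hilbert basis converge to those
of `F` converges weakly to `F`. -/
theorem HilbertBasis.tendsto_inner_of_tendsto_repr {ι E : Type*} [NormedAddCommGroup E]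
    [InnerProductSpace ℂ E] (b : HilbertBasis ι ℂ E) {u : ℕ → E} {R : ℝ}
    (hR : ∀ n, ‖u n‖ ≤ R) {F : E}
    (hF : ∀ i, Tendsto (fun n => b.repr (u n) i) atTop (𝓝 (b.repr F i))) (g : E) :
    Tendsto (fun n => inner ℂ g (u n)) atTop (𝓝 (inner ℂ g F)) := by
  have hcl : IsClosed {g : E | Tendsto (fun n => inner ℂ g (u n - F)) atTop (𝓝 0)} := by
    refine isClosed_of_closure_subset fun g hg => ?_
    rw [Set.mem_ofPred_eq, Metric.tendsto_atTop]
    intro ε hε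
    have hKpos : 0 < R + ‖F‖ + 1 := by linarith [norm_nonneg F, (norm_nonneg _).trans (hR 0)]
    obtain ⟨p, hp, hgp⟩ := Metric.mem_closure_iff.1 hg (ε / (2 * (R + ‖F‖ + 1))) (by positivity)
    obtain ⟨N, hN⟩ := Metric.tendsto_atTop.1 hp (ε / 2) (by positivity)
    refine ⟨N, fun n hn => ?_⟩
    have h1 : ‖inner ℂ p (u n - F)‖ < ε / 2 := by simpa using hN n hn
    have h2 : ‖inner ℂ (g - p) (u n - F)‖ ≤ ε / (2 * (R + ‖F‖ + 1)) * (R + ‖F‖ + 1) := by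
      refine (norm_inner_le_norm _ _).trans (mul_le_mul ?_ ?_ (norm_nonneg _) (by positivity))
      · rw [← dist_eq_norm]; exact hgp.le
      · refine (norm_sub_le _ _).trans ?_
        linarith [hR n]
    have h3 : ε / (2 * (R + ‖F‖ + 1)) * (R + ‖F‖ + 1) = ε / 2 := by field_simp
    rw [dist_zero_right, show inner ℂ g (u n - F) =
      inner ℂ p (u n - F) + inner ℂ (g - p) (u n - F) by rw [inner_sub_left]; ring]
    linarith [norm_add_le (inner ℂ p (u n - F)) (inner ℂ (g - p) (u n - F))]
  have hmem : g ∈ {g : E | Tendsto (fun n => inner ℂ g (u n - F)) atTop (𝓝 0)} := by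
    refine hcl.mem_of_tendsto (b.hasSum_repr g) (Eventually.of_forall fun s => ?_)
    have hpart : ∀ n, inner ℂ (∑ i ∈ s, b.repr g i • b i) (u n - F) =
        ∑ i ∈ s, (starRingEnd ℂ) (b.repr g i) * (b.repr (u n) i - b.repr F i) := by
      intro n
      rw [sum_inner]
      refine Finset.sum_congr rfl fun i _ => ?_
      rw [inner_smul_left, inner_sub_right, b.repr_apply_apply (u n), b.repr_apply_apply F]
    simp_rw [Set.mem_ofPred_eq, hpart]
    rw [show (0 : ℂ) = ∑ i ∈ s, (starRingEnd ℂ) (b.repr g i) * (b.repr F i - b.repr F i) by simp]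
    exact tendsto_finsetSum _ fun i _ => ((hF i).sub_const _).const_mul _
  have h := (hmem : Tendsto _ _ _).add_const (inner ℂ g F)
  simpa [inner_sub_right] using h

open Filter Topology in
/-- In a Hilbert space, a bounded sequence whose coordinates in a Hilbert basis converge is weakly
convergent. -/
theorem HilbertBasis.exists_weak_limit {ι E : Type*} [NormedAddCommGroup E]
    [InnerProductSpace ℂ E] (b : HilbertBasis ι ℂ E) {u : ℕ → E} {R : ℝ}
    (hR : ∀ n, ‖u n‖ ≤ R) {c : ι → ℂ}
    (hc : ∀ i, Tendsto (fun n => b.repr (u n) i) atTop (𝓝 (c i))) :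
    ∃ F : E, (∀ i, b.repr F i = c i) ∧
      ∀ g : E, Tendsto (fun n => inner ℂ g (u n)) atTop (𝓝 (inner ℂ g F)) := by
  have hmem : Memℓp c 2 := by
    refine lp.memℓp_of_tendsto (l := atTop) (F := fun n => b.repr (u n)) ?_
      (tendsto_pi_nhds.2 hc)
    refine isBounded_iff_forall_norm_le.2 ⟨R, ?_⟩
    rintro _ ⟨n, rfl⟩
    simpa using hR n
  have hFc : ∀ i, b.repr (b.repr.symm ⟨c, hmem⟩) i = c i := fun i => by
    rw [LinearIsometryEquiv.apply_symm_apply]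
  refine ⟨b.repr.symm ⟨c, hmem⟩, hFc, fun g => ?_⟩
  refine b.tendsto_inner_of_tendsto_repr hR (fun i => ?_) g
  rw [hFc]
  exact hc i

/-! ### Completeness of the space of pairs -/

/-- The inclusion `supp f ⊆ E` in a closed set means that `f` vanishes almost everywhere off `E`. -/
theorem essentialSupport_subset_iff (f : TorusLinfty) {E : Set Torus} (hE : IsClosed E) :
    essentialSupport f ⊆ E ↔ ∀ᵐ t ∂torusMeasure, t ∉ E → f t = 0 := by
  have hm : Measurable fun t => ‖f t‖ₑ := (Lp.stronglyMeasurable f).measurable.enorm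
  have key : (torusMeasure.withDensity fun t => ‖f t‖ₑ) Eᶜ = 0 ↔
      ∀ᵐ t ∂torusMeasure, t ∉ E → f t = 0 := by
    rw [withDensity_apply _ hE.measurableSet.compl, lintegral_eq_zero_iff hm,
      Filter.EventuallyEq, ae_restrict_iff' hE.measurableSet.compl]
    simp
  rw [← key]
  constructor
  · intro h
    exact measure_mono_null (Set.compl_subset_compl.2 h) Measure.measure_compl_support
  · intro h
    exact Measure.support_subset_of_isClosed hE h

theorem torusFourier_toLp {u : Torus → ℝ} (hu : MemLp u ⊤ torusMeasure) (n : ℤ) :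
    torusFourier (hu.toLp u) n = fourierCoeff (fun t => (u t : ℂ)) n := by
  refine congrFun (fourierCoeff_congr_ae ?_) n
  filter_upwards [hu.coeFn_toLp] with t ht
  rw [ht]

theorem TorusLinfty.norm_toL2_le {f : TorusLinfty}
    (hf : ∀ᵐ t ∂torusMeasure, 0 ≤ f t ∧ f t ≤ 2) : ‖f.toL2‖ ≤ 2 := by
  have h := Lp.norm_le_of_ae_bound (f := f.toL2) (C := 2) (by norm_num) (by
    filter_upwards [hf, f.coeFn_toL2] with t ht h2
    rw [h2, Complex.norm_real, Real.norm_eq_abs, abs_of_nonneg ht.1]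
    exact ht.2)
  simpa [measureUnivNNReal] using h

open Filter Topology in
/-- The functions with values in `[0, 2]` are sequentially weak-* compact: if the Fourier
coefficients of such functions converge, the limits are the coefficients of such a function, and
the integrals over measurable sets converge. -/
theorem exists_limit_of_tendsto_torusFourier {f : ℕ → TorusLinfty}
    (hf : ∀ n, ∀ᵐ t ∂torusMeasure, 0 ≤ f n t ∧ f n t ≤ 2) {c : ℤ → ℂ}
    (hc : ∀ k, Tendsto (fun n => torusFourier (f n) k) atTop (𝓝 (c k))) :
    ∃ F : TorusLinfty, (∀ k, torusFourier F k = c k) ∧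
      (∀ᵐ t ∂torusMeasure, 0 ≤ F t ∧ F t ≤ 2) ∧
      ∀ A : Set Torus, MeasurableSet A →
        Tendsto (fun n => ∫ t in A, f n t ∂torusMeasure) atTop
          (𝓝 (∫ t in A, F t ∂torusMeasure)) := by
  obtain ⟨G, hGc, hG⟩ := fourierBasis.exists_weak_limit
    (u := fun n => (f n).toL2) (fun n => TorusLinfty.norm_toL2_le (hf n)) (c := c)
    (fun k => by simpa only [← torusFourier_eq_repr] using hc k)
  have hGint : Integrable (G : Torus → ℂ) torusMeasure := (Lp.memLp G).integrable (by norm_num)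
  have hGre : Integrable (fun t => (G t).re) torusMeasure := hGint.re
  have hfint : ∀ n, Integrable (f n : Torus → ℝ) torusMeasure :=
    fun n => (Lp.memLp (f n)).integrable le_top
  have hset : ∀ A : Set Torus, MeasurableSet A →
      Tendsto (fun n => ((∫ t in A, f n t ∂torusMeasure : ℝ) : ℂ)) atTop
        (𝓝 (∫ t in A, G t ∂torusMeasure)) := by
    intro A hA
    have h := hG (indicatorConstLp 2 hA (measure_ne_top _ _) (1 : ℂ))
    simp only [L2.inner_indicatorConstLp_one] at h
    refine h.congr fun n => ?_
    rw [← integral_complex_ofReal]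
    exact integral_congr_ae (ae_restrict_of_ae (f n).coeFn_toL2)
  have hre : ∀ A : Set Torus, MeasurableSet A →
      Tendsto (fun n => ∫ t in A, f n t ∂torusMeasure) atTop
        (𝓝 (∫ t in A, (G t).re ∂torusMeasure)) := by
    intro A hA
    have h := (Complex.continuous_re.tendsto _).comp (hset A hA)
    rw [show ∫ t in A, (G t).re ∂torusMeasure = (∫ t in A, G t ∂torusMeasure).re from
      integral_re hGint.integrableOn]
    exact h
  have him : ∀ A : Set Torus, MeasurableSet A → ∫ t in A, (G t).im ∂torusMeasure = 0 := by
    intro A hA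
    have h := (Complex.continuous_im.tendsto _).comp (hset A hA)
    rw [show ∫ t in A, (G t).im ∂torusMeasure = (∫ t in A, G t ∂torusMeasure).im from
      integral_im hGint.integrableOn]
    refine tendsto_nhds_unique h ?_
    simp [Function.comp_def]
  have h0 : 0 ≤ᵐ[torusMeasure] fun t => (G t).re := by
    refine ae_nonneg_of_forall_setIntegral_nonneg hGint.re fun A hA _ => ?_
    exact ge_of_tendsto' (hre A hA) fun n =>
      integral_nonneg_of_ae (ae_restrict_of_ae ((hf n).mono fun t ht => ht.1))
  have h2 : 0 ≤ᵐ[torusMeasure] fun t => 2 - (G t).re := by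
    refine ae_nonneg_of_forall_setIntegral_nonneg ((integrable_const _).sub hGre)
      fun A hA _ => ?_
    rw [integral_sub (integrable_const _) hGre.integrableOn]
    refine ge_of_tendsto' ((hre A hA).const_sub _) fun n => ?_
    rw [← integral_sub (integrable_const _) (hfint n).integrableOn]
    exact integral_nonneg_of_ae
      (ae_restrict_of_ae ((hf n).mono fun t ht => sub_nonneg.2 ht.2))
  have hi : (fun t => (G t).im) =ᵐ[torusMeasure] 0 :=
    Integrable.ae_eq_zero_of_forall_setIntegral_eq_zero hGint.im fun A hA _ => him A hA
  have hmem : MemLp (fun t => (G t).re) ⊤ torusMeasure := by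
    refine memLp_top_of_bound hGint.re.aestronglyMeasurable 2 ?_
    filter_upwards [h0, h2] with t ht0 ht2
    rw [Real.norm_eq_abs, abs_of_nonneg ht0]
    exact sub_nonneg.1 ht2
  refine ⟨hmem.toLp _, fun k => ?_, ?_, fun A hA => ?_⟩
  · rw [torusFourier_toLp, ← hGc, fourierBasis_repr]
    refine congrFun (fourierCoeff_congr_ae ?_) k
    filter_upwards [hi] with t ht
    exact Complex.ext (by simp) (by simpa using ht.symm)
  · filter_upwards [h0, h2, hmem.coeFn_toLp] with t ht0 ht2 ht
    rw [ht]
    exact ⟨ht0, sub_nonneg.1 ht2⟩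
  · rw [integral_congr_ae (ae_restrict_of_ae hmem.coeFn_toLp)]
    exact hre A hA

open Filter Topology in
/-- The condition `supp f ⊆ E` passes to the limit. -/
theorem essentialSupport_subset_of_tendsto {f : ℕ → TorusLinfty} {F : TorusLinfty}
    {E : ℕ → TopologicalSpace.NonemptyCompacts Torus} {K : TopologicalSpace.NonemptyCompacts Torus}
    (hfE : ∀ n, essentialSupport (f n) ⊆ (E n : Set Torus)) (hE : Tendsto E atTop (𝓝 K))
    (hF : ∀ᵐ t ∂torusMeasure, 0 ≤ F t)
    (hint : ∀ A : Set Torus, MeasurableSet A →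
      Tendsto (fun n => ∫ t in A, f n t ∂torusMeasure) atTop (𝓝 (∫ t in A, F t ∂torusMeasure))) :
    essentialSupport F ⊆ (K : Set Torus) := by
  rw [essentialSupport_subset_iff _ K.isCompact.isClosed]
  have hk : ∀ k : ℕ, ∀ᵐ t ∂torusMeasure,
      1 / ((k : ℝ) + 1) < Metric.infDist t (K : Set Torus) → F t = 0 := by
    intro k
    have hA : MeasurableSet {t : Torus | 1 / ((k : ℝ) + 1) < Metric.infDist t (K : Set Torus)} :=
      (isOpen_lt continuous_const (Metric.continuous_infDist_pt _)).measurableSet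
    have hFint : Integrable (F : Torus → ℝ) torusMeasure := (Lp.memLp F).integrable le_top
    have hzero : ∫ t in {t : Torus | 1 / ((k : ℝ) + 1) < Metric.infDist t (K : Set Torus)},
        F t ∂torusMeasure = 0 := by
      refine tendsto_nhds_unique (hint _ hA) (tendsto_const_nhds.congr' ?_)
      filter_upwards [Metric.tendsto_nhds.1 hE (1 / ((k : ℝ) + 1)) (by positivity)] with n hn
      refine (integral_eq_zero_of_ae ?_).symm
      rw [Filter.EventuallyEq, ae_restrict_iff' hA]
      filter_upwards [(essentialSupport_subset_iff _ (E n).isCompact.isClosed).1 (hfE n)]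
        with t ht htA
      refine ht fun htE => ?_
      have h1 := infDist_le_dist (K := K) htE
      exact absurd (htA : _ < _) (not_lt.2 (h1.trans hn.le))
    have h := (setIntegral_eq_zero_iff_of_nonneg_ae (ae_restrict_of_ae hF)
      hFint.integrableOn).1 hzero
    exact (ae_restrict_iff' hA).1 h
  filter_upwards [ae_all_iff.2 hk] with t ht htK
  have hpos : 0 < Metric.infDist t (K : Set Torus) :=
    (K.isCompact.isClosed.notMem_iff_infDist_pos K.nonempty).1 htK
  obtain ⟨k, hk⟩ := exists_nat_one_div_lt hpos
  exact ht k hk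

open Filter Topology in
theorem completeSpace_supportPair {lam : ℕ → ℝ} (hpos : ∀ n, 0 < lam n) :
    let _ := pairMetricSpace hpos
    CompleteSpace (SupportPair lam) := by
  let _ := pairMetricSpace hpos
  have hdist : ∀ p q : SupportPair lam, dist p q = hausdorffSum p.E q.E +
      dist (weightedLp hpos p.f p.mem_weighted) (weightedLp hpos q.f q.mem_weighted) :=
    pairDist_eq hpos
  refine Metric.complete_of_cauchySeq_tendsto fun u hu => ?_
  have hE : CauchySeq fun n => (u n).E := by
    refine Metric.cauchySeq_iff.2 fun ε hε => ?_
    obtain ⟨N, hN⟩ := Metric.cauchySeq_iff.1 hu ε hε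
    refine ⟨N, fun m hm n hn => lt_of_le_of_lt ?_ (hN m hm n hn)⟩
    rw [hdist]
    exact (dist_le_hausdorffSum _ _).trans (le_add_of_nonneg_right dist_nonneg)
  have hw : CauchySeq fun n => weightedLp hpos (u n).f (u n).mem_weighted := by
    refine Metric.cauchySeq_iff.2 fun ε hε => ?_
    obtain ⟨N, hN⟩ := Metric.cauchySeq_iff.1 hu ε hε
    refine ⟨N, fun m hm n hn => lt_of_le_of_lt ?_ (hN m hm n hn)⟩
    rw [hdist]
    exact le_add_of_nonneg_left (hausdorffSum_nonneg _ _)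
  obtain ⟨K, hK⟩ := cauchySeq_tendsto_of_complete hE
  obtain ⟨v, hv⟩ := cauchySeq_tendsto_of_complete hw
  have hsqrt : ∀ k : ℤ, (Real.sqrt (lam k.natAbs) : ℂ) ≠ 0 := fun k => by
    exact_mod_cast (Real.sqrt_pos.2 (hpos _)).ne'
  have hc : ∀ k : ℤ, Tendsto (fun n => torusFourier (u n).f k) atTop
      (𝓝 ((Real.sqrt (lam k.natAbs) : ℂ)⁻¹ * v k)) := by
    intro k
    have h1 : Tendsto (fun n => weightedLp hpos (u n).f (u n).mem_weighted k) atTop (𝓝 (v k)) :=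
      ((lp.evalCLM ℂ (fun _ : ℤ => ℂ) 2 k).continuous.tendsto v).comp hv
    refine (h1.const_mul _).congr fun n => ?_
    exact inv_mul_cancel_left₀ (hsqrt k) _
  obtain ⟨F, hFc, hF, hint⟩ := exists_limit_of_tendsto_torusFourier (fun n => (u n).bounds) hc
  have hFv : weightedSeq lam F = v := by
    ext k
    rw [weightedSeq, hFc]
    exact mul_inv_cancel_left₀ (hsqrt k) _
  have hFmem : MemWeightedL2 lam F := by
    rw [memWeightedL2_iff_memlp hpos, hFv]
    exact lp.memℓp v
  have hsupp := essentialSupport_subset_of_tendsto (fun n => (u n).support_subset) hK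
    (hF.mono fun t ht => ht.1) hint
  refine ⟨⟨F, K, hF, hsupp, hFmem⟩, tendsto_iff_dist_tendsto_zero.2 ?_⟩
  have hFv' : weightedLp hpos F hFmem = v := Subtype.ext hFv
  have h1 := tendsto_iff_dist_tendsto_zero.1 hK
  have h2 := tendsto_iff_dist_tendsto_zero.1 hv
  refine squeeze_zero (fun _ => dist_nonneg) (fun n => ?_)
    (by simpa using (h1.const_mul 2).add h2)
  rw [hdist, hFv']
  exact add_le_add_left (hausdorffSum_le_two_mul_dist _ _) _

/-! ### Reduction by the Baire category theorem -/

theorem setOf_interior_eq_empty_eq_iInter (lam : ℕ → ℝ) :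
    {p : SupportPair lam | interior (p.E : Set Torus) = ∅} =
      ⋂ U ∈ TopologicalSpace.countableBasis Torus,
        {p : SupportPair lam | ¬ U ⊆ (p.E : Set Torus)} := by
  ext p
  simp only [Set.mem_ofPred_eq, Set.mem_iInter]
  constructor
  · intro h U hU hUE
    have h1 := interior_maximal hUE (TopologicalSpace.isOpen_of_mem_countableBasis hU)
    rw [h] at h1
    exact (TopologicalSpace.nonempty_of_mem_countableBasis hU).ne_empty
      (Set.subset_empty_iff.1 h1)
  · intro h
    by_contra hne
    obtain ⟨x, hx⟩ := Set.nonempty_iff_ne_empty.2 hne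
    obtain ⟨U, hU, -, hUE⟩ :=
      (TopologicalSpace.isBasis_countableBasis Torus).exists_subset_of_mem_open hx isOpen_interior
    exact h U hU (hUE.trans interior_subset)

theorem isOpen_setOf_not_subset {lam : ℕ → ℝ} (hpos : ∀ n, 0 < lam n) (U : Set Torus) :
    let _ := pairMetricSpace hpos
    IsOpen {p : SupportPair lam | ¬ U ⊆ (p.E : Set Torus)} := by
  let _ := pairMetricSpace hpos
  refine Metric.isOpen_iff.2 fun p hp => ?_
  obtain ⟨x, hxU, hxE⟩ := Set.not_subset.1 hp
  have hx : 0 < Metric.infDist x (p.E : Set Torus) :=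
    (p.E.isCompact.isClosed.notMem_iff_infDist_pos p.E.nonempty).1 hxE
  refine ⟨_, hx, fun q hq => Set.not_subset.2 ⟨x, hxU, fun hxq => ?_⟩⟩
  have h1 : pairDist q p < Metric.infDist x (p.E : Set Torus) := hq
  have h2 := infDist_le_hausdorffExcess (K := p.E) hxq
  have h3 : hausdorffSum q.E p.E ≤ pairDist q p := by
    rw [pairDist_eq hpos]
    exact le_add_of_nonneg_right dist_nonneg
  rw [hausdorffSum_eq] at h3
  linarith [hausdorffExcess_nonneg p.E q.E]

/-- By the Baire category theorem, density of the pairs with nowhere dense second member follows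
from the density of the pairs whose second member does not contain a given open set. -/
theorem isGδ_and_dense_of_forall_exists {lam : ℕ → ℝ} (hpos : ∀ n, 0 < lam n)
    (h : ∀ U : Set Torus, IsOpen U → U.Nonempty → ∀ p : SupportPair lam, ∀ ε : ℝ, 0 < ε →
      ∃ q : SupportPair lam, pairDist p q < ε ∧ ¬ U ⊆ (q.E : Set Torus)) :
    let _ := pairMetricSpace hpos
    IsGδ {p : SupportPair lam | interior (p.E : Set Torus) = ∅} ∧
      Dense {p : SupportPair lam | interior (p.E : Set Torus) = ∅} := by
  let _ := pairMetricSpace hpos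
  have _ := completeSpace_supportPair hpos
  simp only [setOf_interior_eq_empty_eq_iInter]
  constructor
  · exact IsGδ.biInter (TopologicalSpace.countable_countableBasis Torus)
      fun U _ => (isOpen_setOf_not_subset hpos U).isGδ
  · refine dense_biInter_of_isOpen (fun U _ => isOpen_setOf_not_subset hpos U)
      (TopologicalSpace.countable_countableBasis Torus) fun U hU => ?_
    refine Metric.dense_iff.2 fun p ε hε => ?_
    obtain ⟨q, hq, hqU⟩ := h U (TopologicalSpace.isOpen_of_mem_countableBasis hU)
      (TopologicalSpace.nonempty_of_mem_countableBasis hU) p ε hε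
    exact ⟨q, by rw [Metric.mem_ball, dist_comm]; exact hq, hqU⟩

/-! ### Bumps with vanishing moments -/

/-- `u` is a smooth even function on the line which vanishes off `(-R, R)`. Evenness makes
`t ↦ u ‖t‖` a function on the circle that agrees with `u` in the coordinate on `(-π, π]`. -/
structure IsEvenBump (u : ℝ → ℝ) (R : ℝ) : Prop where
  contDiff : ContDiff ℝ (⊤ : ℕ∞) u
  even : ∀ x, u (-x) = u x
  eq_zero : ∀ x, R ≤ |x| → u x = 0

namespace IsEvenBump

variable {u : ℝ → ℝ} {R : ℝ}

theorem apply_abs (hu : IsEvenBump u R) (x : ℝ) : u |x| = u x := by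
  rcases abs_choice x with h | h <;> rw [h]
  exact hu.even x

theorem hasCompactSupport (hu : IsEvenBump u R) : HasCompactSupport u := by
  refine HasCompactSupport.intro (isCompact_Icc (a := -R) (b := R)) fun x hx => hu.eq_zero x ?_
  by_contra! h
  exact hx ⟨(abs_lt.1 h).1.le, (abs_lt.1 h).2.le⟩

theorem continuous (hu : IsEvenBump u R) : Continuous u := hu.contDiff.continuous

theorem integrable_mul (hu : IsEvenBump u R) {g : ℝ → ℝ} (hg : Continuous g) :
    Integrable fun x => g x * u x :=
  (hg.mul hu.continuous).integrable_of_hasCompactSupport hu.hasCompactSupport.mul_left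

theorem comp_mul (hu : IsEvenBump u R) {s : ℝ} (hs : 0 < s) :
    IsEvenBump (fun x => u (s * x)) (R / s) where
  contDiff := hu.contDiff.comp (contDiff_const.mul contDiff_id)
  even x := by rw [mul_neg, hu.even]
  eq_zero x hx := hu.eq_zero _ (by
    rw [abs_mul, abs_of_pos hs, mul_comm]
    exact (div_le_iff₀ hs).1 hx)

theorem integral_pow_mul_comp_mul (u : ℝ → ℝ) (k : ℕ) {s : ℝ} (hs : 0 < s) :
    ∫ x, x ^ k * u (s * x) = (s ^ (k + 1))⁻¹ * ∫ x, x ^ k * u x := by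
  have h := Measure.integral_comp_mul_left (fun y => y ^ k * u y) s
  rw [smul_eq_mul, abs_of_pos (inv_pos.2 hs)] at h
  simp_rw [mul_pow, mul_assoc] at h
  rw [integral_const_mul] at h
  rw [pow_succ, mul_inv, mul_assoc, ← h, inv_mul_cancel_left₀ (pow_pos hs k).ne']

end IsEvenBump

/-- Construction of `exists_cutoff`, before rescaling the support. If `u` has vanishing moments of
order less than `M`, then so has `u - τ u(s ·)`, and `τ = s ^ (M + 1)` kills the moment of order
`M`. For small `s` the dilate `u(s ·)` is `1` on the support of `u` and `τ` is small, so that after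
division by `1 - τ` the bounds `-ε ≤ u ≤ 1` survive. -/
theorem exists_isEvenBump_moments_eq_zero (M : ℕ) : ∀ ε : ℝ, 0 < ε → ∃ (u : ℝ → ℝ) (R : ℝ),
    1 ≤ R ∧ IsEvenBump u R ∧ (∀ x, |x| ≤ 1 → u x = 1) ∧ (∀ x, -ε ≤ u x ∧ u x ≤ 1) ∧
      ∀ k < M, ∫ x, x ^ k * u x = 0 := by
  induction M with
  | zero =>
    intro ε hε
    let f : ContDiffBump (0 : ℝ) := ⟨1, 2, one_pos, one_lt_two⟩
    refine ⟨f, 2, one_le_two, ⟨f.contDiff, fun x => f.neg x, fun x hx => ?_⟩, fun x hx => ?_,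
      fun x => ⟨by linarith [f.nonneg (x := x)], f.le_one⟩, fun k hk => absurd hk (by simp)⟩
    · exact f.zero_of_le_dist (by simpa [f] using hx)
    · exact f.one_of_mem_closedBall (by simpa [f] using hx)
  | succ M ih =>
    intro ε' hε'
    obtain ⟨ε, hε, hεε', hε1⟩ : ∃ ε : ℝ, 0 < ε ∧ ε ≤ ε' ∧ ε ≤ 1 :=
      ⟨min ε' 1, lt_min hε' one_pos, min_le_left _ _, min_le_right _ _⟩
    obtain ⟨u, R, hR, hu, hu1, hub, hum⟩ := ih (ε / 2) (by positivity)
    have hR0 : 0 < R := by linarith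
    obtain ⟨s, hs, hsR, hsε⟩ : ∃ s : ℝ, 0 < s ∧ s * R ≤ 1 ∧ s ≤ ε / 4 := by
      refine ⟨min R⁻¹ (ε / 4), by positivity, ?_, min_le_right _ _⟩
      calc min R⁻¹ (ε / 4) * R ≤ R⁻¹ * R := by gcongr; exact min_le_left _ _
        _ = 1 := inv_mul_cancel₀ hR0.ne'
    have hs1 : s ≤ 1 := by linarith
    obtain ⟨τ, hτ⟩ : ∃ τ, τ = s ^ (M + 1) := ⟨_, rfl⟩
    have hτ0 : 0 < τ := by rw [hτ]; positivity
    have hτε : τ ≤ ε / 4 := by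
      rw [hτ]
      exact (pow_le_of_le_one hs.le hs1 (Nat.succ_ne_zero M)).trans hsε
    have hτ1 : 0 < 1 - τ := by linarith
    have hus := hu.comp_mul hs
    have hRs : R ≤ R / s := by rw [le_div_iff₀ hs]; nlinarith
    -- On the support of `u` the dilate `u (s ·)` equals `1`.
    have hdil : ∀ x, |x| ≤ R → u (s * x) = 1 := fun x hx => hu1 _ (by
      rw [abs_mul, abs_of_pos hs]
      nlinarith)
    refine ⟨fun x => (u x - τ * u (s * x)) / (1 - τ), R / s, hR.trans hRs,
      ⟨(hu.contDiff.sub (contDiff_const.mul hus.contDiff)).div_const _, fun x => ?_,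
        fun x hx => ?_⟩, fun x hx => ?_, fun x => ?_, fun k hk => ?_⟩
    · rw [hu.even, hus.even]
    · rw [hu.eq_zero x (hRs.trans hx), hus.eq_zero x hx]
      simp
    · change (u x - τ * u (s * x)) / (1 - τ) = 1
      rw [hu1 x hx, hdil x (hx.trans hR), mul_one, div_self hτ1.ne']
    · rw [le_div_iff₀ hτ1, div_le_iff₀ hτ1]
      have h1 := hub x
      have h2 := hub (s * x)
      rcases le_total |x| R with hx | hx
      · rw [hdil x hx]
        constructor <;> nlinarith
      · rw [hu.eq_zero x hx]
        constructor <;> nlinarith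
    · have hint : ∫ x, x ^ k * ((u x - τ * u (s * x)) / (1 - τ)) =
          ((∫ x, x ^ k * u x) - τ * ∫ x, x ^ k * u (s * x)) / (1 - τ) := by
        rw [← integral_const_mul, ← integral_sub (hu.integrable_mul (continuous_pow k))
          ((hus.integrable_mul (continuous_pow k)).const_mul _), ← integral_div]
        congr 1
        ext x
        ring
      rw [hint, IsEvenBump.integral_pow_mul_comp_mul u k hs]
      rcases Nat.lt_succ_iff_lt_or_eq.1 hk with hk | rfl
      · rw [hum k hk]
        simp
      · rw [hτ, mul_inv_cancel_left₀ (pow_pos hs _).ne', sub_self, zero_div]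

/-- A smooth even cut-off which equals `1` near `0`, is at most `1`, is nearly nonnegative, and has
many vanishing moments. -/
theorem exists_cutoff (M : ℕ) {ε : ℝ} (hε : 0 < ε) : ∃ (u : ℝ → ℝ) (r : ℝ),
    0 < r ∧ IsEvenBump u 1 ∧ (∀ x, |x| ≤ r → u x = 1) ∧ (∀ x, -ε ≤ u x ∧ u x ≤ 1) ∧
      ∀ k < M, ∫ x, x ^ k * u x = 0 := by
  obtain ⟨u, R, hR, hu, hu1, hub, hum⟩ := exists_isEvenBump_moments_eq_zero M ε hε
  have hR0 : 0 < R := by linarith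
  refine ⟨fun x => u (R * x), R⁻¹, inv_pos.2 hR0, ?_, fun x hx => hu1 _ ?_, fun x => hub _,
    fun k hk => ?_⟩
  · simpa [div_self hR0.ne'] using hu.comp_mul hR0
  · rw [abs_mul, abs_of_pos hR0]
    calc R * |x| ≤ R * R⁻¹ := by gcongr
      _ = 1 := mul_inv_cancel₀ hR0.ne'
  · rw [IsEvenBump.integral_pow_mul_comp_mul u k hR0, hum k hk, mul_zero]

/-! ### Fourier transforms of bumps -/

/-- The Fourier transform on the line, `ξ ↦ (2π)⁻¹ ∫ e^{-iξy} u(y) dy`. -/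
def lineFourier (u : ℝ → ℝ) (ξ : ℝ) : ℂ :=
  (2 * Real.pi : ℂ)⁻¹ * ∫ y : ℝ, Complex.exp (-(ξ * y * Complex.I)) * (u y : ℂ)

open scoped FourierTransform in
theorem lineFourier_eq (u : ℝ → ℝ) (ξ : ℝ) :
    lineFourier u ξ = (2 * Real.pi : ℂ)⁻¹ * 𝓕 (fun y => (u y : ℂ)) (ξ / (2 * Real.pi)) := by
  rw [lineFourier, Real.fourier_eq']
  congr 2
  ext y
  rw [smul_eq_mul]
  congr 2
  have : (Real.pi : ℂ) ≠ 0 := by exact_mod_cast Real.pi_ne_zero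
  simp
  field_simp

/-- The Fourier transform of a bump decreases rapidly. -/
theorem IsEvenBump.pow_mul_norm_lineFourier_le {u : ℝ → ℝ} {R : ℝ} (hu : IsEvenBump u R) (m : ℕ) :
    ∃ C : ℝ, ∀ ξ, |ξ| ^ m * ‖lineFourier u ξ‖ ≤ C := by
  have hcs : HasCompactSupport fun y => (u y : ℂ) :=
    hu.hasCompactSupport.comp_left Complex.ofReal_zero
  have hcd : ContDiff ℝ (⊤ : ℕ∞) fun y => (u y : ℂ) := Complex.ofRealCLM.contDiff.comp hu.contDiff
  obtain ⟨C, -, hC⟩ := (FourierTransform.fourier (hcs.toSchwartzMap hcd)).decay m 0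
  have h2 : 0 < 2 * Real.pi := Real.two_pi_pos
  refine ⟨(2 * Real.pi) ^ m * (2 * Real.pi)⁻¹ * C, fun ξ => ?_⟩
  have h := hC (ξ / (2 * Real.pi))
  rw [norm_iteratedFDeriv_zero, SchwartzMap.fourier_coe, Real.norm_eq_abs, abs_div,
    abs_of_pos h2, div_pow] at h
  rw [lineFourier_eq, norm_mul]
  have h3 : ‖(2 * Real.pi : ℂ)⁻¹‖ = (2 * Real.pi)⁻¹ := by
    rw [norm_inv, show (2 * Real.pi : ℂ) = ((2 * Real.pi : ℝ) : ℂ) by push_cast; rfl,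
      Complex.norm_real, Real.norm_eq_abs, abs_of_pos h2]
  rw [h3]
  refine le_trans (le_of_eq ?_)
    (mul_le_mul_of_nonneg_left h (by positivity : 0 ≤ (2 * Real.pi) ^ m * (2 * Real.pi)⁻¹))
  change _ = _ * (_ * ‖FourierTransform.fourier (fun y => (u y : ℂ)) (ξ / (2 * Real.pi))‖)
  field_simp

theorem integrable_lineFourier {u : ℝ → ℝ} {R : ℝ} (hu : IsEvenBump u R) {g : ℝ → ℂ}
    (hg : Continuous g) : Integrable fun y => g y * (u y : ℂ) := by
  have hcs : HasCompactSupport fun y => (u y : ℂ) :=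
    hu.hasCompactSupport.comp_left Complex.ofReal_zero
  exact (hg.mul (Complex.continuous_ofReal.comp hu.continuous)).integrable_of_hasCompactSupport
    hcs.mul_left

theorem IsEvenBump.norm_lineFourier_le_pow_of_abs_le_one {u : ℝ → ℝ} (hu : IsEvenBump u 1) {M : ℕ}
    (hum : ∀ k < M, ∫ x, x ^ k * u x = 0) {ξ : ℝ} (hξ : |ξ| ≤ 1) :
    ‖lineFourier u ξ‖ ≤ ‖(2 * Real.pi : ℂ)⁻¹‖ * (Real.exp 1 * ∫ y, |u y|) * |ξ| ^ M := by
  -- Subtracting the Taylor polynomial of the exponential does not change the integral.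
  have htaylor : ∫ y : ℝ, Complex.exp (-(ξ * y * Complex.I)) * (u y : ℂ) =
      ∫ y : ℝ, (Complex.exp (-(ξ * y * Complex.I)) -
        ∑ k ∈ Finset.range M, (-(ξ * y * Complex.I)) ^ k / (k.factorial : ℂ)) * (u y : ℂ) := by
    have hsum : ∫ y : ℝ, (∑ k ∈ Finset.range M,
        (-(ξ * y * Complex.I)) ^ k / (k.factorial : ℂ)) * (u y : ℂ) = 0 := by
      simp_rw [Finset.sum_mul]
      rw [integral_finsetSum _ fun k _ => integrable_lineFourier hu (by fun_prop)]
      refine Finset.sum_eq_zero fun k hk => ?_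
      have h1 : ∀ y : ℝ, (-(ξ * y * Complex.I)) ^ k / (k.factorial : ℂ) * (u y : ℂ) =
          ((-(ξ * Complex.I)) ^ k / (k.factorial : ℂ)) * ((y ^ k * u y : ℝ) : ℂ) := by
        intro y
        push_cast
        ring
      simp_rw [h1]
      rw [integral_const_mul, integral_complex_ofReal, hum k (Finset.mem_range.1 hk)]
      simp
    simp_rw [sub_mul]
    rw [integral_sub (integrable_lineFourier hu (by fun_prop))
      (integrable_lineFourier hu (by fun_prop)), hsum, sub_zero]
  rw [lineFourier, htaylor, norm_mul, mul_assoc, mul_assoc]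
  refine mul_le_mul_of_nonneg_left ?_ (norm_nonneg _)
  have hint : Integrable fun y => |u y| :=
    (hu.continuous.integrable_of_hasCompactSupport hu.hasCompactSupport).abs
  rw [mul_comm (∫ y, |u y|), ← mul_assoc, ← integral_const_mul]
  refine norm_integral_le_of_norm_le (hint.const_mul _) (Filter.Eventually.of_forall fun y => ?_)
  rw [norm_mul, Complex.norm_real, Real.norm_eq_abs]
  rcases le_total 1 |y| with hy | hy
  · simp [hu.eq_zero y hy]
  refine mul_le_mul_of_nonneg_right ?_ (abs_nonneg _)
  have hn : ‖-((ξ : ℂ) * y * Complex.I)‖ = |ξ| * |y| := by simp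
  have h := Complex.norm_exp_sub_sum_le_norm_mul_exp (-((ξ : ℂ) * y * Complex.I)) M
  rw [hn] at h
  have h1 : |ξ| * |y| ≤ |ξ| := mul_le_of_le_one_right (abs_nonneg _) hy
  calc _ ≤ (|ξ| * |y|) ^ M * Real.exp (|ξ| * |y|) := h
    _ ≤ |ξ| ^ M * Real.exp 1 := by
        gcongr
        exact h1.trans hξ
    _ = _ := mul_comm _ _

/-- The Fourier transform of a bump with vanishing moments is concentrated at frequencies of
order `1`. -/
theorem IsEvenBump.exists_lineFourier_bound {u : ℝ → ℝ} (hu : IsEvenBump u 1) {M : ℕ}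
    (hum : ∀ k < M, ∫ x, x ^ k * u x = 0) :
    ∃ C : ℝ, 0 < C ∧ ∀ ξ, ‖lineFourier u ξ‖ ≤ C * |ξ| ^ M ∧ |ξ| ^ M * ‖lineFourier u ξ‖ ≤ C := by
  obtain ⟨C₁, hC₁⟩ := hu.pow_mul_norm_lineFourier_le M
  obtain ⟨C₂, hC₂⟩ : ∃ C, C = ‖(2 * Real.pi : ℂ)⁻¹‖ * (Real.exp 1 * ∫ y, |u y|) := ⟨_, rfl⟩
  obtain ⟨C, hC, h1, h2⟩ : ∃ C, 0 < C ∧ C₁ ≤ C ∧ C₂ ≤ C :=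
    ⟨max 1 (max C₁ C₂), by positivity, by simp, by simp⟩
  refine ⟨C, hC, fun ξ => ⟨?_, (hC₁ ξ).trans h1⟩⟩
  rcases le_total |ξ| 1 with hξ | hξ
  · refine (hu.norm_lineFourier_le_pow_of_abs_le_one hum hξ).trans ?_
    rw [← hC₂]
    gcongr
  · have hp : 1 ≤ |ξ| ^ M := one_le_pow₀ hξ
    have h3 := hC₁ ξ
    nlinarith [norm_nonneg (lineFourier u ξ)]

theorem continuous_lineFourier {u : ℝ → ℝ} {R : ℝ} (hu : IsEvenBump u R) :
    Continuous (lineFourier u) := by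
  refine continuous_const.mul (continuous_of_dominated (bound := fun y => |u y|) (fun ξ => ?_)
    (fun ξ => Filter.Eventually.of_forall fun y => ?_)
    (hu.continuous.integrable_of_hasCompactSupport hu.hasCompactSupport).abs
    (Filter.Eventually.of_forall fun y => by fun_prop))
  · exact (integrable_lineFourier hu (by fun_prop)).aestronglyMeasurable
  · rw [norm_mul, Complex.norm_real, Real.norm_eq_abs,
      show -((ξ : ℂ) * y * Complex.I) = ((-(ξ * y) : ℝ) : ℂ) * Complex.I by push_cast; ring,
      Complex.norm_exp_ofReal_mul_I, one_mul]

/-- The Fourier coefficients of a dilated bump on the circle are samples of the Fourier transform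
on the line. -/
theorem fourierCoeff_comp_mul_norm {u : ℝ → ℝ} (hu : IsEvenBump u 1) {σ : ℝ} (hσ : 1 ≤ σ)
    (n : ℤ) :
    fourierCoeff (fun t : Torus => (u (σ * ‖t‖) : ℂ)) n = (σ : ℂ)⁻¹ * lineFourier u (n / σ) := by
  have hσ0 : 0 < σ := by linarith
  have hπ : (Real.pi : ℂ) ≠ 0 := by exact_mod_cast Real.pi_ne_zero
  have hπ3 := Real.pi_gt_three
  rw [fourierCoeff_eq_intervalIntegral _ n (-Real.pi),
    intervalIntegral.integral_of_le (by linarith)]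
  have h1 : ∫ x in Set.Ioc (-Real.pi) (-Real.pi + 2 * Real.pi),
      fourier (-n) (x : Torus) • (u (σ * ‖(x : Torus)‖) : ℂ) =
      ∫ x in Set.Ioc (-Real.pi) (-Real.pi + 2 * Real.pi),
        Complex.exp (-(n * x * Complex.I)) * (u (σ * x) : ℂ) := by
    refine setIntegral_congr_fun measurableSet_Ioc fun x hx => ?_
    have hxabs : |x| ≤ |2 * Real.pi| / 2 := by
      rw [abs_of_pos Real.two_pi_pos, abs_le]
      constructor <;> linarith [hx.1, hx.2]
    have hnorm := (AddCircle.norm_coe_eq_abs_iff (2 * Real.pi) Real.two_pi_pos.ne').2 hxabs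
    change fourier (-n) (x : Torus) • (u (σ * ‖(x : Torus)‖) : ℂ) = _
    rw [hnorm, ← abs_of_pos hσ0, ← abs_mul, hu.apply_abs, abs_of_pos hσ0, fourier_coe_apply,
      smul_eq_mul]
    congr 2
    push_cast
    field_simp
  have h2 : ∫ x in Set.Ioc (-Real.pi) (-Real.pi + 2 * Real.pi),
        Complex.exp (-(n * x * Complex.I)) * (u (σ * x) : ℂ) =
      ∫ x : ℝ, Complex.exp (-(n * x * Complex.I)) * (u (σ * x) : ℂ) := by
    refine setIntegral_eq_integral_of_forall_compl_eq_zero fun x hx => ?_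
    rw [hu.eq_zero, Complex.ofReal_zero, mul_zero]
    by_contra! h
    rw [abs_mul, abs_of_pos hσ0] at h
    have hx1 : |x| < 1 := by nlinarith [abs_nonneg x]
    have h3 := abs_lt.1 hx1
    exact hx ⟨by linarith, by linarith⟩
  have h3 := Measure.integral_comp_mul_left
    (fun y : ℝ => Complex.exp (-(((n / σ : ℝ) : ℂ) * y * Complex.I)) * (u y : ℂ)) σ
  have h4 : ∫ x : ℝ, Complex.exp (-(n * x * Complex.I)) * (u (σ * x) : ℂ) =
      ∫ x : ℝ, Complex.exp (-(((n / σ : ℝ) : ℂ) * ((σ * x : ℝ) : ℂ) * Complex.I)) *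
        (u (σ * x) : ℂ) := by
    congr 1
    ext x
    have : (σ : ℂ) ≠ 0 := by exact_mod_cast hσ0.ne'
    congr 3
    push_cast
    field_simp
  rw [h1, h2, h4, h3, lineFourier, abs_of_pos (inv_pos.2 hσ0)]
  simp only [Complex.real_smul, one_div]
  push_cast
  ring

/-! ### Doubling weights -/

/-- A doubling sequence varies at most polynomially. -/
theorem exists_growth_of_doubling {lam : ℕ → ℝ} (hpos : ∀ n, 0 < lam n)
    (hdoubling : ∃ C : ℝ, 1 < C ∧ ∀ n : ℕ, 1 ≤ n → ∀ k : ℕ, n ≤ k → k ≤ 2 * n →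
      C⁻¹ * lam n ≤ lam k ∧ lam k ≤ C * lam n) :
    ∃ (C : ℝ) (A : ℕ), 1 ≤ C ∧ ∀ m n : ℕ, 1 ≤ m → m ≤ n →
      lam n ≤ C * ((n : ℝ) / m) ^ A * lam m ∧ lam m ≤ C * ((n : ℝ) / m) ^ A * lam n := by
  obtain ⟨C, hC, hd⟩ := hdoubling
  have hC0 : 0 < C := by linarith
  obtain ⟨A, hA⟩ := pow_unbounded_of_one_lt C (one_lt_two : (1 : ℝ) < 2)
  refine ⟨C, A, hC.le, ?_⟩
  suffices h : ∀ d m n : ℕ, n - m ≤ d → 1 ≤ m → m ≤ n →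
      lam n ≤ C * ((n : ℝ) / m) ^ A * lam m ∧ lam m ≤ C * ((n : ℝ) / m) ^ A * lam n from
    fun m n hm hmn => h (n - m) m n le_rfl hm hmn
  -- Both bounds hold over one doubling; each further doubling costs `C ≤ 2 ^ A`.
  have hbase : ∀ m n : ℕ, 1 ≤ m → m ≤ n → n ≤ 2 * m → lam n ≤ C * lam m ∧ lam m ≤ C * lam n := by
    intro m n hm hmn hn
    have h := hd m hm n hmn hn
    refine ⟨h.2, ?_⟩
    rw [inv_mul_le_iff₀ hC0] at h
    exact h.1
  intro d
  induction d with
  | zero =>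
    intro m n hd0 hm hmn
    obtain rfl : m = n := by omega
    have : (m : ℝ) ≠ 0 := by positivity
    rw [div_self this, one_pow, mul_one, and_self]
    nlinarith [hpos m]
  | succ d ih =>
    intro m n hdn hm hmn
    have hm0 : (0 : ℝ) < m := by exact_mod_cast hm
    by_cases hn : n ≤ 2 * m
    · have h1 : (1 : ℝ) ≤ ((n : ℝ) / m) ^ A :=
        one_le_pow₀ ((one_le_div hm0).2 (by exact_mod_cast hmn))
      have h2 := hbase m n hm hmn hn
      have h3 : C ≤ C * ((n : ℝ) / m) ^ A := le_mul_of_one_le_right hC0.le h1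
      exact ⟨h2.1.trans (mul_le_mul_of_nonneg_right h3 (hpos m).le),
        h2.2.trans (mul_le_mul_of_nonneg_right h3 (hpos n).le)⟩
    · obtain ⟨h1, h2⟩ := ih (2 * m) n (by omega) (by omega) (by omega)
      obtain ⟨h3, h4⟩ := hbase m (2 * m) hm (by omega) le_rfl
      have hstep : C * (C * ((n : ℝ) / ((2 * m : ℕ) : ℝ)) ^ A) ≤ C * ((n : ℝ) / m) ^ A := by
        have h5 : ((n : ℝ) / m) ^ A = 2 ^ A * ((n : ℝ) / ((2 * m : ℕ) : ℝ)) ^ A := by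
          rw [← mul_pow]
          congr 1
          push_cast
          field_simp
        rw [h5]
        gcongr
      constructor
      · calc lam n ≤ C * ((n : ℝ) / ((2 * m : ℕ) : ℝ)) ^ A * lam (2 * m) := h1
          _ ≤ C * ((n : ℝ) / ((2 * m : ℕ) : ℝ)) ^ A * (C * lam m) := by gcongr
          _ = C * (C * ((n : ℝ) / ((2 * m : ℕ) : ℝ)) ^ A) * lam m := by ring
          _ ≤ _ := mul_le_mul_of_nonneg_right hstep (hpos m).le
      · calc lam m ≤ C * lam (2 * m) := h4
          _ ≤ C * (C * ((n : ℝ) / ((2 * m : ℕ) : ℝ)) ^ A * lam n) := by gcongr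
          _ = C * (C * ((n : ℝ) / ((2 * m : ℕ) : ℝ)) ^ A) * lam n := by ring
          _ ≤ _ := mul_le_mul_of_nonneg_right hstep (hpos n).le

/-- The two-sided proximity `min (x / y, y / x)` of two nonnegative numbers. -/
def proximity (x y : ℝ) : ℝ := min (x / y) (y / x)

theorem proximity_nonneg {x y : ℝ} (hx : 0 ≤ x) (hy : 0 ≤ y) : 0 ≤ proximity x y :=
  le_min (div_nonneg hx hy) (div_nonneg hy hx)

theorem proximity_le_one {x y : ℝ} (hx : 0 ≤ x) (hy : 0 ≤ y) : proximity x y ≤ 1 := by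
  rcases le_total x y with h | h
  · exact (min_le_left _ _).trans (div_le_one_of_le₀ h hy)
  · exact (min_le_right _ _).trans (div_le_one_of_le₀ h hx)

theorem mul_proximity_pow_le {lam : ℕ → ℝ} (hpos : ∀ n, 0 < lam n) {C : ℝ} {A : ℕ}
    (hg : ∀ m n : ℕ, 1 ≤ m → m ≤ n →
      lam n ≤ C * ((n : ℝ) / m) ^ A * lam m ∧ lam m ≤ C * ((n : ℝ) / m) ^ A * lam n)
    {m n : ℕ} (hm : 1 ≤ m) (hn : 1 ≤ n) :
    lam n * proximity n m ^ A ≤ C * lam m := by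
  have hm0 : (0 : ℝ) < m := by exact_mod_cast hm
  have hn0 : (0 : ℝ) < n := by exact_mod_cast hn
  have hp := proximity_nonneg hn0.le hm0.le
  have hln := (hpos n).le
  rcases le_total m n with h | h
  · calc lam n * proximity n m ^ A ≤ lam n * ((m : ℝ) / n) ^ A := by
          gcongr
          exact min_le_right _ _
      _ ≤ C * ((n : ℝ) / m) ^ A * lam m * ((m : ℝ) / n) ^ A := by
          gcongr
          exact (hg m n hm h).1
      _ = C * lam m * ((n : ℝ) / m * (m / n)) ^ A := by rw [mul_pow]; ring
      _ = C * lam m := by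
          rw [show (n : ℝ) / m * (m / n) = 1 by field_simp, one_pow, mul_one]
  · calc lam n * proximity n m ^ A ≤ lam n * ((n : ℝ) / m) ^ A := by
          gcongr
          exact min_le_left _ _
      _ ≤ C * ((m : ℝ) / n) ^ A * lam m * ((n : ℝ) / m) ^ A := by
          gcongr
          exact (hg n m hn h).2
      _ = C * lam m * ((m : ℝ) / n * (n / m)) ^ A := by rw [mul_pow]; ring
      _ = C * lam m := by
          rw [show (m : ℝ) / n * (n / m) = 1 by field_simp, one_pow, mul_one]

/-- The weights `λ_{|n|}` are moderate: a shift by `k` changes them by at most a power of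
`1 + |k|`. -/
theorem exists_moderate_of_growth {lam : ℕ → ℝ} (hpos : ∀ n, 0 < lam n) {C : ℝ} {A : ℕ}
    (hC : 1 ≤ C) (hg : ∀ m n : ℕ, 1 ≤ m → m ≤ n →
      lam n ≤ C * ((n : ℝ) / m) ^ A * lam m ∧ lam m ≤ C * ((n : ℝ) / m) ^ A * lam n) :
    ∃ D : ℝ, 0 < D ∧ ∀ n m : ℤ,
      lam n.natAbs ≤ D * (1 + |((n - m : ℤ) : ℝ)|) ^ A * lam m.natAbs := by
  obtain ⟨B, hB0, hB1, hB2⟩ : ∃ B : ℝ, 1 ≤ B ∧ lam 0 ≤ B * lam 1 ∧ lam 1 ≤ B * lam 0 :=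
    ⟨max 1 (max (lam 0 / lam 1) (lam 1 / lam 0)), le_max_left _ _,
      (div_le_iff₀ (hpos 1)).1 (by simp), (div_le_iff₀ (hpos 0)).1 (by simp)⟩
  have hmax : ∀ k : ℕ, lam k ≤ B * lam (max 1 k) ∧ lam (max 1 k) ≤ B * lam k := by
    intro k
    rcases Nat.eq_zero_or_pos k with rfl | hk
    · exact ⟨hB1, hB2⟩
    · rw [max_eq_right hk]
      constructor <;> nlinarith [hpos k]
  refine ⟨B * C * B, by positivity, fun n m => ?_⟩
  obtain ⟨a, ha⟩ : ∃ a, a = max 1 n.natAbs := ⟨_, rfl⟩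
  obtain ⟨b, hb⟩ : ∃ b, b = max 1 m.natAbs := ⟨_, rfl⟩
  obtain ⟨k, hk⟩ : ∃ k : ℕ, k = (n - m).natAbs := ⟨_, rfl⟩
  have hkr : |((n - m : ℤ) : ℝ)| = k := by rw [hk, Nat.cast_natAbs, Int.cast_abs]
  have ha1 : 1 ≤ a := by omega
  have hb1 : 1 ≤ b := by omega
  have ha0 : (0 : ℝ) < a := by exact_mod_cast ha1
  have hb0 : (0 : ℝ) < b := by exact_mod_cast hb1
  have hab : a ≤ (1 + k) * b := by nlinarith [show a ≤ b + k by omega]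
  have hba : b ≤ (1 + k) * a := by nlinarith [show b ≤ a + k by omega]
  have hab' : (a : ℝ) / b ≤ 1 + k := by
    rw [div_le_iff₀ hb0]
    exact_mod_cast hab
  have hba' : (b : ℝ) / a ≤ 1 + k := by
    rw [div_le_iff₀ ha0]
    exact_mod_cast hba
  have key : lam a ≤ C * (1 + (k : ℝ)) ^ A * lam b := by
    have hlb := (hpos b).le
    rcases le_total b a with h | h
    · refine (hg b a hb1 h).1.trans ?_
      gcongr
    · refine (hg a b ha1 h).2.trans ?_
      gcongr
  have h1 := (hmax n.natAbs).1
  have h2 := (hmax m.natAbs).2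
  rw [← ha] at h1
  rw [← hb] at h2
  rw [hkr]
  calc lam n.natAbs ≤ B * lam a := h1
    _ ≤ B * (C * (1 + (k : ℝ)) ^ A * (B * lam m.natAbs)) := by
        gcongr
        exact key.trans (by gcongr)
    _ = _ := by ring

/-- Cauchy condensation for a doubling sequence. -/
theorem exists_le_sum_condensed {lam : ℕ → ℝ} (hpos : ∀ n, 0 < lam n)
    (hdiv : ¬ Summable (fun n => 1 / lam n))
    (hdoubling : ∃ C : ℝ, 1 < C ∧ ∀ n : ℕ, 1 ≤ n → ∀ k : ℕ, n ≤ k → k ≤ 2 * n →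
      C⁻¹ * lam n ≤ lam k ∧ lam k ≤ C * lam n) (B : ℝ) :
    ∃ J : ℕ, B < ∑ j ∈ Finset.range J, 2 ^ j / lam (2 ^ j) := by
  obtain ⟨C, hC, hd⟩ := hdoubling
  have hC0 : 0 < C := by linarith
  by_contra! hB
  have hblock : ∀ J : ℕ, ∑ n ∈ Finset.range (2 ^ J), 1 / lam n ≤
      1 / lam 0 + C * ∑ j ∈ Finset.range J, 2 ^ j / lam (2 ^ j) := by
    intro J
    induction J with
    | zero => simp
    | succ J ih =>
      rw [← Finset.sum_range_add_sum_Ico _ (Nat.pow_le_pow_right two_pos J.le_succ),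
        Finset.sum_range_succ, mul_add, ← add_assoc]
      refine add_le_add ih ?_
      have hle : ∀ n ∈ Finset.Ico (2 ^ J) (2 ^ (J + 1)), 1 / lam n ≤ C / lam (2 ^ J) := by
        intro n hn
        rw [Finset.mem_Ico, pow_succ] at hn
        have h := (hd (2 ^ J) Nat.one_le_two_pow n hn.1 (by omega)).1
        rw [inv_mul_le_iff₀ hC0] at h
        rw [div_le_div_iff₀ (hpos _) (hpos _), one_mul]
        exact h
      refine (Finset.sum_le_card_nsmul _ _ _ hle).trans (le_of_eq ?_)
      rw [Nat.card_Ico, pow_succ, show 2 ^ J * 2 - 2 ^ J = 2 ^ J by omega, nsmul_eq_mul]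
      push_cast
      ring
  refine hdiv (summable_of_sum_range_le (c := 1 / lam 0 + C * B)
    (fun n => one_div_nonneg.2 (hpos n).le) fun n => ?_)
  refine (Finset.sum_le_sum_of_subset_of_nonneg
    (Finset.range_mono (Nat.lt_two_pow_self (n := n)).le)
    fun k _ _ => one_div_nonneg.2 (hpos k).le).trans ((hblock n).trans ?_)
  have := hB n
  gcongr

/-! ### Sums of proximities -/

/-- The proximities of a point to the dyadic scales have bounded sum: they are dominated by the
increments of `j ↦ -6 / (1 + 2 ^ j / x)`. -/
theorem sum_proximity_two_pow_le {x : ℝ} (hx : 0 < x) (J : ℕ) :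
    ∑ j ∈ Finset.range J, proximity x (2 ^ j) ≤ 6 := by
  have key : ∀ y : ℝ, 0 < y → min y⁻¹ y ≤ 6 / (1 + y) - 6 / (1 + 2 * y) := by
    intro y hy
    rw [div_sub_div _ _ (by positivity) (by positivity), le_div_iff₀ (by positivity)]
    rcases le_total y 1 with h | h
    · have := min_le_right y⁻¹ y
      have h2 : (1 + y) * (1 + 2 * y) ≤ 6 := by nlinarith
      calc min y⁻¹ y * ((1 + y) * (1 + 2 * y)) ≤ y * 6 := by gcongr
        _ = _ := by ring
    · have := min_le_left y⁻¹ y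
      have h2 : (1 + y) * (1 + 2 * y) ≤ 6 * y * y := by nlinarith
      calc min y⁻¹ y * ((1 + y) * (1 + 2 * y)) ≤ y⁻¹ * (6 * y * y) := by gcongr
        _ = 6 * y := by field_simp
        _ = _ := by ring
  have htel : ∀ J : ℕ, ∑ j ∈ Finset.range J, proximity x (2 ^ j) ≤
      6 / (1 + 1 / x) - 6 / (1 + 2 ^ J / x) := by
    intro J
    induction J with
    | zero => simp
    | succ J ih =>
      rw [Finset.sum_range_succ]
      have h := key (2 ^ J / x) (by positivity)
      rw [inv_div] at h
      have h2 : 2 * (2 ^ J / x) = 2 ^ (J + 1) / x := by rw [pow_succ]; ring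
      rw [h2] at h
      have h3 : proximity x (2 ^ J) = min (x / 2 ^ J) (2 ^ J / x) := rfl
      linarith
  refine (htel J).trans ?_
  have h1 : 6 / (1 + 1 / x) ≤ 6 := div_le_self (by norm_num) (by linarith [one_div_pos.2 hx])
  have h2 : 0 ≤ 6 / (1 + 2 ^ J / x) := by positivity
  linarith

/-- The sum is dominated by a telescoping one: for `k ≥ 1` the term is at most
`(2 N / (N + k)) ^ 2`. At `k = 0` it vanishes, as `N / 0 = 0`. -/
theorem sum_range_proximity_sq_le {N : ℝ} (hN : 0 < N) (L : ℕ) :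
    ∑ k ∈ Finset.range L, proximity k N ^ 2 ≤ 4 * N := by
  have hterm : ∀ k : ℕ, proximity ((k + 1 : ℕ) : ℝ) N ^ 2 ≤
      4 * N ^ 2 * (1 / (N + k) - 1 / (N + (k + 1 : ℕ))) := by
    intro k
    have hk : (0 : ℝ) < ((k + 1 : ℕ) : ℝ) := by positivity
    have h1 : proximity ((k + 1 : ℕ) : ℝ) N ≤ 2 * N / (N + (k + 1 : ℕ)) := by
      rw [le_div_iff₀ (by positivity)]
      have hp := proximity_nonneg hk.le hN.le
      rcases le_total ((k + 1 : ℕ) : ℝ) N with h | h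
      · have h2 := proximity_le_one hk.le hN.le
        nlinarith
      · have h2 : proximity ((k + 1 : ℕ) : ℝ) N * ((k + 1 : ℕ) : ℝ) ≤ N :=
          (le_div_iff₀ hk).1 (min_le_right _ _)
        nlinarith
    calc proximity ((k + 1 : ℕ) : ℝ) N ^ 2 ≤ (2 * N / (N + (k + 1 : ℕ))) ^ 2 := by
          gcongr
          exact proximity_nonneg hk.le hN.le
      _ ≤ _ := by
          rw [div_pow, mul_pow, div_sub_div _ _ (by positivity) (by positivity), mul_div_assoc',
            div_le_div_iff₀ (by positivity) (by positivity)]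
          push_cast
          have h0 : (0 : ℝ) ≤ k := by positivity
          nlinarith [mul_pos (sq_pos_of_pos hN) (show (0 : ℝ) < N + k + 1 by positivity)]
  have htel : ∀ L : ℕ, ∑ k ∈ Finset.range (L + 1), proximity k N ^ 2 ≤
      4 * N ^ 2 * (1 / N - 1 / (N + L)) := by
    intro L
    induction L with
    | zero => simp [proximity]
    | succ L ih =>
      rw [Finset.sum_range_succ]
      have := hterm L
      linarith
  refine (Finset.sum_le_sum_of_subset_of_nonneg (Finset.range_mono L.le_succ)
    fun _ _ _ => sq_nonneg _).trans ((htel L).trans ?_)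
  have h1 : 4 * N ^ 2 * (1 / N) = 4 * N := by field_simp
  have h2 : 0 ≤ 4 * N ^ 2 * (1 / (N + L)) := by positivity
  linarith

theorem sum_int_proximity_sq_le {N : ℝ} (hN : 0 < N) (s : Finset ℤ) :
    ∑ n ∈ s, proximity (n.natAbs : ℝ) N ^ 2 ≤ 8 * N := by
  have hinj : ∀ t : Finset ℤ, Set.InjOn Int.natAbs (t : Set ℤ) →
      ∑ n ∈ t, proximity (n.natAbs : ℝ) N ^ 2 ≤ 4 * N := by
    intro t ht
    rw [← Finset.sum_image (f := fun k : ℕ => proximity (k : ℝ) N ^ 2) ht]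
    obtain ⟨L, hL⟩ := (t.image Int.natAbs).exists_nat_subset_range
    exact (Finset.sum_le_sum_of_subset_of_nonneg hL fun _ _ _ => sq_nonneg _).trans
      (sum_range_proximity_sq_le hN L)
  rw [← Finset.sum_filter_add_sum_filter_not s (fun n => 0 ≤ n)]
  have h1 := hinj (s.filter fun n => 0 ≤ n) (fun a ha b hb hab => by
    simp only [Finset.coe_filter, Set.mem_ofPred_eq] at ha hb
    omega)
  have h2 := hinj (s.filter fun n => ¬ 0 ≤ n) (fun a ha b hb hab => by
    simp only [Finset.coe_filter, Set.mem_ofPred_eq] at ha hb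
    omega)
  linarith

/-! ### Points have zero capacity -/

theorem norm_le_mul_proximity_pow {F : ℝ → ℂ} {C : ℝ} {M : ℕ}
    (hF : ∀ ξ, ‖F ξ‖ ≤ C * |ξ| ^ M ∧ |ξ| ^ M * ‖F ξ‖ ≤ C) {n : ℤ} (hn : n ≠ 0) {y : ℝ}
    (hy : 0 < y) : ‖F (n / y)‖ ≤ C * proximity (n.natAbs : ℝ) y ^ M := by
  have hn0 : (0 : ℝ) < n.natAbs := by exact_mod_cast Int.natAbs_pos.2 hn
  have habs : |(n : ℝ) / y| = n.natAbs / y := by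
    rw [abs_div, abs_of_pos hy, Nat.cast_natAbs, Int.cast_abs]
  have h := hF (n / y)
  rw [habs] at h
  rcases min_choice ((n.natAbs : ℝ) / y) (y / n.natAbs) with hm | hm
  · rw [proximity, hm]
    exact h.1
  · rw [proximity, hm, ← inv_div (n.natAbs : ℝ) y, inv_pow, ← div_eq_mul_inv,
      le_div_iff₀ (by positivity), mul_comm]
    exact h.2

/-- Almost orthogonality of the dyadic dilates of a frequency-localized function, in the weighted
`ℓ²` norm: Schur's test with the proximity kernel. -/
theorem sum_weighted_sq_dyadic_le {lam : ℕ → ℝ} (hpos : ∀ n, 0 < lam n) {C : ℝ} {A : ℕ}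
    (hC : 1 ≤ C) (hg : ∀ m n : ℕ, 1 ≤ m → m ≤ n →
      lam n ≤ C * ((n : ℝ) / m) ^ A * lam m ∧ lam m ≤ C * ((n : ℝ) / m) ^ A * lam n)
    {F : ℝ → ℂ} {K : ℝ} (hK : 0 < K)
    (hF : ∀ ξ, ‖F ξ‖ ≤ K * |ξ| ^ (A + 2) ∧ |ξ| ^ (A + 2) * ‖F ξ‖ ≤ K) {a : ℕ → ℝ}
    (J : ℕ) (s : Finset ℤ) :
    ∑ n ∈ s, ‖∑ j ∈ Finset.range J, (a j : ℂ) * (((2 : ℝ) ^ j : ℝ) : ℂ)⁻¹ *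
        F (n / (2 : ℝ) ^ j)‖ ^ 2 * lam n.natAbs ≤
      48 * K ^ 2 * C * ∑ j ∈ Finset.range J, a j ^ 2 * ((2 : ℝ) ^ j)⁻¹ * lam (2 ^ j) := by
  have hpt : ∀ n : ℤ, ‖∑ j ∈ Finset.range J, (a j : ℂ) * (((2 : ℝ) ^ j : ℝ) : ℂ)⁻¹ *
        F (n / (2 : ℝ) ^ j)‖ ^ 2 * lam n.natAbs ≤
      ∑ j ∈ Finset.range J, 6 * K ^ 2 * C * (a j ^ 2 * ((2 : ℝ) ^ j)⁻¹ ^ 2 * lam (2 ^ j)) *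
        proximity (n.natAbs : ℝ) (2 ^ j) ^ 2 := by
    intro n
    by_cases hn : n = 0
    · have h0 : F 0 = 0 := by simpa using (hF 0).1
      subst hn
      simp only [Int.cast_zero, zero_div, h0, mul_zero, Finset.sum_const_zero, norm_zero,
        Int.natAbs_zero]
      have := fun j => (hpos (2 ^ j)).le
      rw [zero_pow two_ne_zero, zero_mul]
      exact Finset.sum_nonneg fun j _ => mul_nonneg (mul_nonneg (by positivity)
        (mul_nonneg (by positivity) (this j))) (sq_nonneg _)
    have hn1 : 1 ≤ n.natAbs := Int.natAbs_pos.2 hn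
    have hn0 : (0 : ℝ) < n.natAbs := by exact_mod_cast hn1
    have hp0 : ∀ j : ℕ, 0 ≤ proximity (n.natAbs : ℝ) (2 ^ j) :=
      fun j => proximity_nonneg hn0.le (by positivity)
    have hp1 : ∀ j : ℕ, proximity (n.natAbs : ℝ) (2 ^ j) ≤ 1 :=
      fun j => proximity_le_one hn0.le (by positivity)
    have hcs : ‖∑ j ∈ Finset.range J, (a j : ℂ) * (((2 : ℝ) ^ j : ℝ) : ℂ)⁻¹ *
        F (n / (2 : ℝ) ^ j)‖ ^ 2 ≤ (∑ j ∈ Finset.range J, proximity (n.natAbs : ℝ) (2 ^ j)) *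
        ∑ j ∈ Finset.range J, a j ^ 2 * ((2 : ℝ) ^ j)⁻¹ ^ 2 * K ^ 2 *
          proximity (n.natAbs : ℝ) (2 ^ j) ^ (A + 2) := by
      refine (pow_le_pow_left₀ (norm_nonneg _) (norm_sum_le _ _) 2).trans
        (Finset.sum_sq_le_sum_mul_sum_of_sq_le_mul _ (fun j _ => hp0 j)
          (fun j _ => mul_nonneg (by positivity) (pow_nonneg (hp0 j) _)) fun j _ => ?_)
      have h1 := norm_le_mul_proximity_pow hF hn (y := 2 ^ j) (by positivity)
      have h2 : ‖(a j : ℂ) * (((2 : ℝ) ^ j : ℝ) : ℂ)⁻¹ * F (n / (2 : ℝ) ^ j)‖ ^ 2 =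
          a j ^ 2 * ((2 : ℝ) ^ j)⁻¹ ^ 2 * ‖F (n / (2 : ℝ) ^ j)‖ ^ 2 := by
        rw [norm_mul, norm_mul, norm_inv, Complex.norm_real, Complex.norm_real, mul_pow, mul_pow,
          Real.norm_eq_abs, Real.norm_eq_abs, sq_abs, abs_of_pos (by positivity)]
      rw [h2]
      calc a j ^ 2 * ((2 : ℝ) ^ j)⁻¹ ^ 2 * ‖F (n / (2 : ℝ) ^ j)‖ ^ 2
          ≤ a j ^ 2 * ((2 : ℝ) ^ j)⁻¹ ^ 2 *
              (K * proximity (n.natAbs : ℝ) (2 ^ j) ^ (A + 2)) ^ 2 := by gcongr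
        _ = a j ^ 2 * ((2 : ℝ) ^ j)⁻¹ ^ 2 * K ^ 2 *
              (proximity (n.natAbs : ℝ) (2 ^ j) ^ (A + 2) *
                proximity (n.natAbs : ℝ) (2 ^ j) ^ (A + 2)) := by ring
        _ ≤ a j ^ 2 * ((2 : ℝ) ^ j)⁻¹ ^ 2 * K ^ 2 *
              (proximity (n.natAbs : ℝ) (2 ^ j) *
                proximity (n.natAbs : ℝ) (2 ^ j) ^ (A + 2)) := by
            have h3 := hp0 j
            have h4 : proximity (n.natAbs : ℝ) (2 ^ j) ^ (A + 2) ≤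
                proximity (n.natAbs : ℝ) (2 ^ j) :=
              pow_le_of_le_one (hp0 j) (hp1 j) (by omega)
            gcongr
        _ = _ := by ring
    have hln := (hpos n.natAbs).le
    calc _ ≤ (6 * ∑ j ∈ Finset.range J, a j ^ 2 * ((2 : ℝ) ^ j)⁻¹ ^ 2 * K ^ 2 *
          proximity (n.natAbs : ℝ) (2 ^ j) ^ (A + 2)) * lam n.natAbs := by
          refine mul_le_mul_of_nonneg_right (hcs.trans ?_) hln
          refine mul_le_mul_of_nonneg_right (sum_proximity_two_pow_le hn0 J)
            (Finset.sum_nonneg fun j _ => mul_nonneg (by positivity) (pow_nonneg (hp0 j) _))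
      _ = ∑ j ∈ Finset.range J, 6 * K ^ 2 * (a j ^ 2 * ((2 : ℝ) ^ j)⁻¹ ^ 2) *
            (lam n.natAbs * proximity (n.natAbs : ℝ) (2 ^ j) ^ A) *
            proximity (n.natAbs : ℝ) (2 ^ j) ^ 2 := by
          rw [Finset.mul_sum, Finset.sum_mul]
          refine Finset.sum_congr rfl fun j _ => ?_
          ring
      _ ≤ ∑ j ∈ Finset.range J, 6 * K ^ 2 * (a j ^ 2 * ((2 : ℝ) ^ j)⁻¹ ^ 2) *
            (C * lam (2 ^ j)) * proximity (n.natAbs : ℝ) (2 ^ j) ^ 2 := by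
          refine Finset.sum_le_sum fun j _ => ?_
          have h := mul_proximity_pow_le hpos hg (m := 2 ^ j) (n := n.natAbs)
            Nat.one_le_two_pow hn1
          push_cast at h
          gcongr
      _ = _ := Finset.sum_congr rfl fun j _ => by ring
  calc _ ≤ ∑ n ∈ s, ∑ j ∈ Finset.range J,
        6 * K ^ 2 * C * (a j ^ 2 * ((2 : ℝ) ^ j)⁻¹ ^ 2 * lam (2 ^ j)) *
        proximity (n.natAbs : ℝ) (2 ^ j) ^ 2 := Finset.sum_le_sum fun n _ => hpt n
    _ = ∑ j ∈ Finset.range J, 6 * K ^ 2 * C * (a j ^ 2 * ((2 : ℝ) ^ j)⁻¹ ^ 2 * lam (2 ^ j)) *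
        ∑ n ∈ s, proximity (n.natAbs : ℝ) (2 ^ j) ^ 2 := by
        rw [Finset.sum_comm]
        simp_rw [Finset.mul_sum]
    _ ≤ ∑ j ∈ Finset.range J, 6 * K ^ 2 * C * (a j ^ 2 * ((2 : ℝ) ^ j)⁻¹ ^ 2 * lam (2 ^ j)) *
        (8 * 2 ^ j) := by
        refine Finset.sum_le_sum fun j _ => ?_
        have := (hpos (2 ^ j)).le
        gcongr
        exact sum_int_proximity_sq_le (by positivity) s
    _ = _ := by
        rw [Finset.mul_sum]
        refine Finset.sum_congr rfl fun j _ => ?_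
        field_simp
        ring

/-- Points have zero capacity: there are continuous functions, equal to `1` near the origin, with
values in `[-ε, 1]`, and arbitrarily small in the weighted norm. They are averages of dyadic
dilates of one cut-off, with weights proportional to `2 ^ j / λ_{2 ^ j}`. -/
theorem exists_small_cutoff {lam : ℕ → ℝ} (hpos : ∀ n, 0 < lam n)
    (hdiv : ¬ Summable (fun n => 1 / lam n))
    (hdoubling : ∃ C : ℝ, 1 < C ∧ ∀ n : ℕ, 1 ≤ n → ∀ k : ℕ, n ≤ k → k ≤ 2 * n →
      C⁻¹ * lam n ≤ lam k ∧ lam k ≤ C * lam n) {ε η : ℝ} (hε : 0 < ε) (hη : 0 < η) :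
    ∃ (h : Torus → ℝ) (r : ℝ), Continuous h ∧ 0 < r ∧ (∀ t, ‖t‖ ≤ r → h t = 1) ∧
      (∀ t, -ε ≤ h t ∧ h t ≤ 1) ∧
      ∀ s : Finset ℤ, ∑ n ∈ s, ‖fourierCoeff (fun t => (h t : ℂ)) n‖ ^ 2 * lam n.natAbs ≤ η := by
  obtain ⟨C, A, hC, hg⟩ := exists_growth_of_doubling hpos hdoubling
  obtain ⟨u, r, hr, hu, hu1, hub, hum⟩ := exists_cutoff (A + 2) hε
  obtain ⟨K, hK, hF⟩ := hu.exists_lineFourier_bound hum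
  obtain ⟨J, hJ⟩ := exists_le_sum_condensed hpos hdiv hdoubling (48 * K ^ 2 * C / η)
  obtain ⟨S, hS⟩ : ∃ S, S = ∑ j ∈ Finset.range J, (2 : ℝ) ^ j / lam (2 ^ j) := ⟨_, rfl⟩
  rw [← hS] at hJ
  have hS0 : 0 < S := lt_of_le_of_lt (by positivity) hJ
  obtain ⟨a, ha⟩ : ∃ a : ℕ → ℝ, ∀ j, a j = 2 ^ j / lam (2 ^ j) / S := ⟨_, fun _ => rfl⟩
  have ha0 : ∀ j, 0 ≤ a j := fun j => by
    rw [ha]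
    have := hpos (2 ^ j)
    positivity
  have ha1 : ∑ j ∈ Finset.range J, a j = 1 := by
    simp_rw [ha]
    rw [← Finset.sum_div, ← hS, div_self hS0.ne']
  have hcost : ∑ j ∈ Finset.range J, a j ^ 2 * ((2 : ℝ) ^ j)⁻¹ * lam (2 ^ j) = S⁻¹ := by
    rw [← mul_one S⁻¹, ← ha1, Finset.mul_sum]
    refine Finset.sum_congr rfl fun j _ => ?_
    have := hpos (2 ^ j)
    rw [ha]
    field_simp
  have hcont : ∀ j : ℕ, Continuous fun t : Torus => u (2 ^ j * ‖t‖) :=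
    fun j => hu.continuous.comp (continuous_const.mul continuous_norm)
  refine ⟨fun t => ∑ j ∈ Finset.range J, a j * u (2 ^ j * ‖t‖), r / 2 ^ J, ?_, by positivity,
    fun t ht => ?_, fun t => ⟨?_, ?_⟩, fun s => ?_⟩
  · exact continuous_finsetSum _ fun j _ => (hcont j).const_mul _
  · change ∑ j ∈ Finset.range J, a j * u (2 ^ j * ‖t‖) = 1
    rw [← ha1]
    refine Finset.sum_congr rfl fun j hj => ?_
    rw [hu1, mul_one]
    rw [abs_of_nonneg (by positivity)]
    have h1 : (2 : ℝ) ^ j ≤ 2 ^ J :=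
      pow_le_pow_right₀ one_le_two (Finset.mem_range.1 hj).le
    calc 2 ^ j * ‖t‖ ≤ 2 ^ J * (r / 2 ^ J) := by gcongr
      _ = r := by field_simp
  · calc -ε = ∑ j ∈ Finset.range J, a j * (-ε) := by rw [← Finset.sum_mul, ha1, one_mul]
      _ ≤ _ := Finset.sum_le_sum fun j _ => mul_le_mul_of_nonneg_left (hub _).1 (ha0 j)
  · calc _ ≤ ∑ j ∈ Finset.range J, a j * 1 :=
          Finset.sum_le_sum fun j _ => mul_le_mul_of_nonneg_left (hub _).2 (ha0 j)
      _ = 1 := by rw [← Finset.sum_mul, ha1, one_mul]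
  · have hcoeff : ∀ n : ℤ, fourierCoeff (fun t : Torus =>
        ((∑ j ∈ Finset.range J, a j * u (2 ^ j * ‖t‖) : ℝ) : ℂ)) n =
        ∑ j ∈ Finset.range J, (a j : ℂ) * (((2 : ℝ) ^ j : ℝ) : ℂ)⁻¹ *
          lineFourier u (n / (2 : ℝ) ^ j) := by
      intro n
      have h1 : (fun t : Torus => ((∑ j ∈ Finset.range J, a j * u (2 ^ j * ‖t‖) : ℝ) : ℂ)) =
          ∑ j ∈ Finset.range J, fun t : Torus => (a j : ℂ) * (u (2 ^ j * ‖t‖) : ℂ) := by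
        ext t
        simp
      rw [h1, fourierCoeff.sum, Finset.sum_apply]
      · refine Finset.sum_congr rfl fun j _ => ?_
        rw [fourierCoeff.const_mul,
          fourierCoeff_comp_mul_norm hu (one_le_pow₀ one_le_two) n, mul_assoc]
      · intro j _
        have h2 := (Complex.continuous_ofReal.comp (hcont j)).const_mul (a j : ℂ)
        exact h2.integrable_of_hasCompactSupport (HasCompactSupport.of_compactSpace _)
    simp_rw [hcoeff]
    refine (sum_weighted_sq_dyadic_le hpos hC hg hK hF J s).trans ?_
    rw [hcost, ← div_eq_mul_inv, div_le_iff₀ hS0]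
    rw [div_lt_iff₀ hη] at hJ
    linarith

/-! ### Translations and products on the circle -/

theorem norm_fourierCoeff_comp_sub (g : Torus → ℂ) (x : Torus) (n : ℤ) :
    ‖fourierCoeff (fun t => g (t - x)) n‖ = ‖fourierCoeff g n‖ := by
  have h : fourierCoeff (fun t => g (t - x)) n = fourier (-n) x * fourierCoeff g n := by
    rw [fourierCoeff, fourierCoeff, ← integral_const_mul,
      ← integral_add_right_eq_self (fun t => fourier (-n) t • g (t - x)) x]
    refine integral_congr_ae (Filter.Eventually.of_forall fun t => ?_)
    simp only [add_sub_cancel_right, smul_eq_mul]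
    rw [← mul_assoc]
    congr 1
    simp only [fourier_apply, smul_add, AddCircle.toCircle_add, Circle.coe_mul]
    rw [mul_comm]
  rw [h, norm_mul, fourier_apply, Circle.norm_coe, one_mul]

/-- The Fourier coefficients of a product are given by the convolution of the coefficients. -/
theorem hasSum_fourierCoeff_mul {f g : Torus → ℂ} (hf : MemLp f 2 torusMeasure)
    (hg : MemLp g 2 torusMeasure) (n : ℤ) :
    HasSum (fun k => fourierCoeff f k * fourierCoeff g (n - k))
      (fourierCoeff (fun t => f t * g t) n) := by
  have hgn : MemLp (fun t => fourier (-n) t * g t) 2 torusMeasure := by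
    refine hg.of_le ((fourier (-n)).continuous.aestronglyMeasurable.mul hg.1)
      (Filter.Eventually.of_forall fun t => ?_)
    rw [norm_mul, fourier_apply, Circle.norm_coe, one_mul]
  have hfs : MemLp (fun t => (starRingEnd ℂ) (f t)) 2 torusMeasure :=
    hf.of_le (Complex.continuous_conj.comp_aestronglyMeasurable hf.1)
      (Filter.Eventually.of_forall fun t => by simp)
  have h := fourierBasis.hasSum_inner_mul_inner (hfs.toLp _) (hgn.toLp _)
  have h1 : inner ℂ (hfs.toLp _) (hgn.toLp _) = fourierCoeff (fun t => f t * g t) n := by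
    rw [L2.inner_def, fourierCoeff]
    refine integral_congr_ae ?_
    filter_upwards [hfs.coeFn_toLp, hgn.coeFn_toLp] with t h1 h2
    rw [h1, h2]
    simp
    ring
  have h2 : ∀ k : ℤ, inner ℂ (hfs.toLp _) (fourierBasis k) = fourierCoeff f (-k) := by
    intro k
    rw [L2.inner_def, fourierCoeff, coe_fourierBasis]
    refine integral_congr_ae ?_
    filter_upwards [hfs.coeFn_toLp, coeFn_fourierLp 2 k] with t h1 h2
    rw [h1, h2]
    simp
  have h3 : ∀ k : ℤ, inner ℂ (fourierBasis k) (hgn.toLp _) = fourierCoeff g (n - (-k)) := by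
    intro k
    rw [← HilbertBasis.repr_apply_apply, fourierBasis_repr,
      fourierCoeff_congr_ae hgn.coeFn_toLp, fourierCoeff, fourierCoeff]
    refine integral_congr_ae (Filter.Eventually.of_forall fun t => ?_)
    change fourier (-k) t • (fourier (-n) t * g t) = fourier (-(n - -k)) t • g t
    rw [smul_eq_mul, smul_eq_mul, ← mul_assoc, ← fourier_add]
    congr 3
    ring
  simp_rw [h2, h3] at h
  rw [h1] at h
  exact (Equiv.neg ℤ).hasSum_iff.1 (by simpa [Function.comp_def] using h)

/-! ### Convolution on weighted `ℓ²` -/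

open scoped ENNReal in
/-- The Cauchy–Schwarz inequality with respect to a discrete measure `a`. -/
theorem ENNReal.sq_tsum_mul_le {ι : Type*} (a b : ι → ℝ≥0∞) :
    (∑' k, a k * b k) ^ 2 ≤ (∑' k, a k) * ∑' k, a k * b k ^ 2 := by
  have hxy : ∀ x y : ℝ≥0∞, 2 * (x * y) ≤ x ^ 2 + y ^ 2 := by
    have : ∀ x y : ℝ≥0∞, x ≤ y → 2 * (x * y) ≤ x ^ 2 + y ^ 2 := by
      intro x y h
      obtain ⟨d, rfl⟩ := exists_add_of_le h
      calc 2 * (x * (x + d)) ≤ 2 * (x * (x + d)) + d ^ 2 := le_self_add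
        _ = _ := by ring
    intro x y
    rcases le_total x y with h | h
    · exact this x y h
    · rw [mul_comm x y, add_comm]
      exact this y x h
  have h2 : 2 * (∑' k, a k * b k) ^ 2 ≤ 2 * ((∑' k, a k) * ∑' k, a k * b k ^ 2) := by
    calc 2 * (∑' k, a k * b k) ^ 2 = ∑' k, ∑' l, a k * a l * (2 * (b k * b l)) := by
          rw [sq, ← ENNReal.tsum_mul_right, ← ENNReal.tsum_mul_left]
          refine tsum_congr fun k => ?_
          rw [← ENNReal.tsum_mul_left, ← ENNReal.tsum_mul_left]
          exact tsum_congr fun l => by ring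
      _ ≤ ∑' k, ∑' l, (a l * (a k * b k ^ 2) + a k * (a l * b l ^ 2)) := by
          refine ENNReal.tsum_le_tsum fun k => ENNReal.tsum_le_tsum fun l => ?_
          calc a k * a l * (2 * (b k * b l)) ≤ a k * a l * (b k ^ 2 + b l ^ 2) := by
                gcongr
                exact hxy _ _
            _ = _ := by ring
      _ = _ := by
          simp_rw [ENNReal.tsum_add, ENNReal.tsum_mul_left, ENNReal.tsum_mul_right,
            ENNReal.tsum_mul_left]
          ring
  exact (ENNReal.mul_le_mul_iff_right two_ne_zero (by simp)).1 h2

theorem tsum_ofReal_le_iff {g : ℤ → ℝ} (hg : ∀ n, 0 ≤ g n) {B : ℝ} (hB : 0 ≤ B) :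
    ∑' n, ENNReal.ofReal (g n) ≤ ENNReal.ofReal B ↔ ∀ s : Finset ℤ, ∑ n ∈ s, g n ≤ B := by
  rw [ENNReal.tsum_eq_iSup_sum, iSup_le_iff]
  refine forall_congr' fun s => ?_
  rw [← ENNReal.ofReal_sum_of_nonneg fun n _ => hg n, ENNReal.ofReal_le_ofReal_iff hB]

/-- Convolution with a rapidly decreasing sequence is bounded on the weighted `ℓ²` space. -/
theorem exists_sum_weighted_convolution_le {lam : ℕ → ℝ} (hpos : ∀ n, 0 < lam n) {D : ℝ} {A : ℕ}
    (hD : 0 < D) (hmod : ∀ n m : ℤ,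
      lam n.natAbs ≤ D * (1 + |((n - m : ℤ) : ℝ)|) ^ A * lam m.natAbs)
    {φ : ℤ → ℂ} (hφ : Summable fun k : ℤ => (1 + |(k : ℝ)|) ^ A * ‖φ k‖) :
    ∃ Q : ℝ, 0 ≤ Q ∧ ∀ (ψ c : ℤ → ℂ) (η : ℝ), 0 ≤ η →
      (∀ n, HasSum (fun k => φ k * ψ (n - k)) (c n)) →
      (∀ s : Finset ℤ, ∑ n ∈ s, ‖ψ n‖ ^ 2 * lam n.natAbs ≤ η) →
      ∀ s : Finset ℤ, ∑ n ∈ s, ‖c n‖ ^ 2 * lam n.natAbs ≤ Q * η := by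
  obtain ⟨T, hT⟩ : ∃ T, T = ∑' k : ℤ, (1 + |(k : ℝ)|) ^ A * ‖φ k‖ := ⟨_, rfl⟩
  have hw1 : ∀ k : ℤ, 1 ≤ (1 + |(k : ℝ)|) ^ A :=
    fun k => one_le_pow₀ (by linarith [abs_nonneg (k : ℝ)])
  have hT0 : 0 ≤ T := by rw [hT]; exact tsum_nonneg fun k => by positivity
  have hTE : ∑' k : ℤ, ENNReal.ofReal ((1 + |(k : ℝ)|) ^ A) * ‖φ k‖ₑ = ENNReal.ofReal T := by
    rw [hT, ENNReal.ofReal_tsum_of_nonneg (fun k => by positivity) hφ]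
    refine tsum_congr fun k => ?_
    rw [ENNReal.ofReal_mul (by positivity), ofReal_norm]
  have hTE' : ∑' k : ℤ, ‖φ k‖ₑ ≤ ENNReal.ofReal T := by
    rw [← hTE]
    refine ENNReal.tsum_le_tsum fun k => le_mul_of_one_le_left (by simp) ?_
    rw [← ENNReal.ofReal_one]
    exact ENNReal.ofReal_le_ofReal (hw1 k)
  have hE : ∀ (v : ℤ → ℂ) (n : ℤ), ENNReal.ofReal (‖v n‖ ^ 2 * lam n.natAbs) =
      ENNReal.ofReal (lam n.natAbs) * ‖v n‖ₑ ^ 2 := fun v n => by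
    rw [mul_comm, ENNReal.ofReal_mul (hpos _).le, ENNReal.ofReal_pow (norm_nonneg _),
      ofReal_norm]
  have hnn : ∀ (v : ℤ → ℂ) (n : ℤ), 0 ≤ ‖v n‖ ^ 2 * lam n.natAbs :=
    fun v n => mul_nonneg (sq_nonneg _) (hpos _).le
  refine ⟨T * (D * T), by positivity, fun ψ c η hη hc hψ => ?_⟩
  rw [← tsum_ofReal_le_iff (hnn ψ) hη] at hψ
  rw [← tsum_ofReal_le_iff (hnn c) (by positivity)]
  simp_rw [hE] at hψ ⊢
  have hcn : ∀ n, ‖c n‖ₑ ^ 2 ≤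
      ENNReal.ofReal T * ∑' k, ‖φ k‖ₑ * ‖ψ (n - k)‖ₑ ^ 2 := by
    intro n
    have h1 : ‖c n‖ₑ ≤ ∑' k, ‖φ k‖ₑ * ‖ψ (n - k)‖ₑ := by
      rw [← (hc n).tsum_eq]
      refine enorm_tsum_le_tsum_enorm.trans (le_of_eq ?_)
      exact tsum_congr fun k => enorm_mul _ _
    exact (pow_le_pow_left' h1 2).trans
      ((ENNReal.sq_tsum_mul_le _ _).trans (mul_le_mul_left hTE' _))
  have hshift : ∀ k : ℤ, ∑' n : ℤ, ENNReal.ofReal (lam n.natAbs) * ‖ψ (n - k)‖ₑ ^ 2 ≤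
      ENNReal.ofReal D * ENNReal.ofReal ((1 + |(k : ℝ)|) ^ A) * ENNReal.ofReal η := by
    intro k
    calc _ ≤ ∑' n : ℤ, ENNReal.ofReal D * ENNReal.ofReal ((1 + |(k : ℝ)|) ^ A) *
          (ENNReal.ofReal (lam (n - k).natAbs) * ‖ψ (n - k)‖ₑ ^ 2) := by
          refine ENNReal.tsum_le_tsum fun n => ?_
          rw [← mul_assoc, ← ENNReal.ofReal_mul hD.le, ← ENNReal.ofReal_mul (by positivity)]
          gcongr
          have h := hmod n (n - k)
          rwa [sub_sub_cancel] at h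
      _ = ENNReal.ofReal D * ENNReal.ofReal ((1 + |(k : ℝ)|) ^ A) *
          ∑' n : ℤ, ENNReal.ofReal (lam n.natAbs) * ‖ψ n‖ₑ ^ 2 := by
          rw [ENNReal.tsum_mul_left]
          congr 1
          exact (Equiv.subRight k).tsum_eq
            (fun n : ℤ => ENNReal.ofReal (lam n.natAbs) * ‖ψ n‖ₑ ^ 2)
      _ ≤ _ := by gcongr
  calc ∑' n : ℤ, ENNReal.ofReal (lam n.natAbs) * ‖c n‖ₑ ^ 2
      ≤ ∑' n : ℤ, ∑' k : ℤ, ENNReal.ofReal T * (‖φ k‖ₑ *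
          (ENNReal.ofReal (lam n.natAbs) * ‖ψ (n - k)‖ₑ ^ 2)) := by
        refine ENNReal.tsum_le_tsum fun n => ?_
        refine (mul_le_mul_right (hcn n) _).trans (le_of_eq ?_)
        rw [← ENNReal.tsum_mul_left, ← ENNReal.tsum_mul_left]
        exact tsum_congr fun k => by ring
    _ = ENNReal.ofReal T * ∑' k : ℤ, ‖φ k‖ₑ *
          ∑' n : ℤ, ENNReal.ofReal (lam n.natAbs) * ‖ψ (n - k)‖ₑ ^ 2 := by
        rw [ENNReal.tsum_comm]
        simp_rw [ENNReal.tsum_mul_left]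
    _ ≤ ENNReal.ofReal T * ∑' k : ℤ, ‖φ k‖ₑ *
          (ENNReal.ofReal D * ENNReal.ofReal ((1 + |(k : ℝ)|) ^ A) * ENNReal.ofReal η) := by
        gcongr with k
        exact hshift k
    _ = ENNReal.ofReal T * (ENNReal.ofReal D *
          (∑' k : ℤ, ENNReal.ofReal ((1 + |(k : ℝ)|) ^ A) * ‖φ k‖ₑ) * ENNReal.ofReal η) := by
        congr 1
        rw [← ENNReal.tsum_mul_left, ← ENNReal.tsum_mul_right]
        exact tsum_congr fun k => by ring
    _ = _ := by
        rw [hTE, ENNReal.ofReal_mul (by positivity), ENNReal.ofReal_mul hT0,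
          ENNReal.ofReal_mul hD.le]
        ring

/-! ### Convolution with an approximate identity -/

theorem exists_nonneg_isEvenBump : ∃ u : ℝ → ℝ, IsEvenBump u 1 ∧ (∀ x, 0 ≤ u x) ∧ u 0 = 1 := by
  let f : ContDiffBump (0 : ℝ) := ⟨1 / 2, 1, by norm_num, by norm_num⟩
  refine ⟨f, ⟨f.contDiff, fun x => f.neg x, fun x hx => ?_⟩, fun x => f.nonneg, ?_⟩
  · exact f.zero_of_le_dist (by simpa [f] using hx)
  · exact f.one_of_mem_closedBall (by simp [f])

open Filter Topology in
/-- A nonnegative approximate identity on the circle with supports shrinking to the origin and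
rapidly decreasing Fourier coefficients. -/
theorem exists_approximate_identity : ∃ φ : ℕ → Torus → ℝ,
    (∀ N, Continuous (φ N)) ∧ (∀ N t, 0 ≤ φ N t) ∧
    (∀ N, ∫ t, φ N t ∂torusMeasure = 1) ∧
    (∀ N : ℕ, ∀ t, 1 / ((N : ℝ) + 1) < ‖t‖ → φ N t = 0) ∧
    (∀ k, Tendsto (fun N => fourierCoeff (fun t => (φ N t : ℂ)) k) atTop (𝓝 1)) ∧
    ∀ (N m : ℕ), ∃ C : ℝ, ∀ k : ℤ,
      |(k : ℝ)| ^ m * ‖fourierCoeff (fun t => (φ N t : ℂ)) k‖ ≤ C := by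
  obtain ⟨u, hu, hu0, hu1⟩ := exists_nonneg_isEvenBump
  obtain ⟨I, hI⟩ : ∃ I, I = (2 * Real.pi)⁻¹ * ∫ y, u y := ⟨_, rfl⟩
  have hI0 : 0 < I := by
    rw [hI]
    have h1 : 0 < ∫ y, u y := hu.continuous.integral_pos_of_hasCompactSupport_nonneg_nonzero
      hu.hasCompactSupport hu0 (x := 0) (by rw [hu1]; exact one_ne_zero)
    have := Real.pi_pos
    positivity
  have hF0 : lineFourier u 0 = I := by
    rw [lineFourier, hI]
    simp [integral_complex_ofReal]
  have hσ : ∀ N : ℕ, (1 : ℝ) ≤ (N : ℝ) + 1 := fun N => by linarith [N.cast_nonneg (α := ℝ)]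
  have hσ0 : ∀ N : ℕ, (0 : ℝ) < (N : ℝ) + 1 := fun N => by positivity
  have hcoeff : ∀ (N : ℕ) (k : ℤ), fourierCoeff
      (fun t : Torus => ((((N : ℝ) + 1) / I * u (((N : ℝ) + 1) * ‖t‖) : ℝ) : ℂ)) k =
      (I : ℂ)⁻¹ * lineFourier u (k / ((N : ℝ) + 1)) := by
    intro N k
    have h : (fun t : Torus => ((((N : ℝ) + 1) / I * u (((N : ℝ) + 1) * ‖t‖) : ℝ) : ℂ)) =
        fun t : Torus => ((((N : ℝ) + 1) / I : ℝ) : ℂ) * (u (((N : ℝ) + 1) * ‖t‖) : ℂ) := by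
      ext t
      push_cast
      ring
    have h0 : (((N : ℝ) + 1 : ℝ) : ℂ) ≠ 0 := by exact_mod_cast (hσ0 N).ne'
    rw [h, fourierCoeff.const_mul, fourierCoeff_comp_mul_norm hu (hσ N), Complex.ofReal_div,
      ← mul_assoc, div_mul_eq_mul_div, mul_inv_cancel₀ h0, one_div]
  refine ⟨fun N t => ((N : ℝ) + 1) / I * u (((N : ℝ) + 1) * ‖t‖), fun N => ?_, fun N t => ?_,
    fun N => ?_, fun N t ht => ?_, fun k => ?_, fun N m => ?_⟩
  · exact (hu.continuous.comp (continuous_const.mul continuous_norm)).const_mul _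
  · exact mul_nonneg (div_pos (hσ0 N) hI0).le (hu0 _)
  · have h := hcoeff N 0
    rw [fourierCoeff] at h
    simp only [neg_zero, fourier_zero, one_smul, Int.cast_zero, zero_div, hF0] at h
    rw [inv_mul_cancel₀ (by exact_mod_cast hI0.ne'), integral_complex_ofReal] at h
    exact_mod_cast h
  · change _ * u _ = 0
    rw [hu.eq_zero, mul_zero]
    rw [abs_of_nonneg (by positivity), mul_comm]
    exact (div_le_iff₀ (hσ0 N)).1 ht.le
  · simp_rw [hcoeff]
    have hlim : Tendsto (fun N : ℕ => (k : ℝ) / ((N : ℝ) + 1)) atTop (𝓝 0) :=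
      tendsto_const_nhds.div_atTop (tendsto_atTop_add_const_right _ _ tendsto_natCast_atTop_atTop)
    have h := (((continuous_lineFourier hu).tendsto 0).comp hlim).const_mul (I : ℂ)⁻¹
    rwa [hF0, inv_mul_cancel₀ (by exact_mod_cast hI0.ne')] at h
  · obtain ⟨C, hC⟩ := hu.pow_mul_norm_lineFourier_le m
    refine ⟨((N : ℝ) + 1) ^ m * I⁻¹ * C, fun k => ?_⟩
    rw [hcoeff, norm_mul, norm_inv, Complex.norm_real, Real.norm_eq_abs, abs_of_pos hI0]
    have h := hC (k / ((N : ℝ) + 1))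
    rw [abs_div, abs_of_pos (hσ0 N), div_pow] at h
    have := hσ0 N
    refine le_trans (le_of_eq ?_)
      (mul_le_mul_of_nonneg_left h (by positivity : 0 ≤ ((N : ℝ) + 1) ^ m * I⁻¹))
    field_simp

/-- The convolution of two functions on the circle. -/
def torusConv (f φ : Torus → ℝ) (t : Torus) : ℝ := ∫ s, f s * φ (t - s) ∂torusMeasure

section Convolution

variable {f : TorusLinfty} {φ : Torus → ℝ}

theorem integrable_mul_comp_sub (f : TorusLinfty) (hφ : Continuous φ) (t : Torus) :
    Integrable (fun s => f s * φ (t - s)) torusMeasure := by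
  obtain ⟨B, hB⟩ := isCompact_univ.exists_bound_of_continuousOn hφ.continuousOn
  exact ((Lp.memLp f).integrable le_top).mul_bdd (c := B)
    (hφ.comp (continuous_const.sub continuous_id)).aestronglyMeasurable
    (Filter.Eventually.of_forall fun s => hB _ (Set.mem_univ _))

theorem torusConv_bounds (hf : ∀ᵐ t ∂torusMeasure, 0 ≤ f t ∧ f t ≤ 2) (hφ : Continuous φ)
    (hφ0 : ∀ t, 0 ≤ φ t) (hφ1 : ∫ t, φ t ∂torusMeasure = 1) (t : Torus) :
    0 ≤ torusConv f φ t ∧ torusConv f φ t ≤ 2 := by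
  constructor
  · exact integral_nonneg_of_ae (hf.mono fun s hs => mul_nonneg hs.1 (hφ0 _))
  · have h1 : ∫ s, 2 * φ (t - s) ∂torusMeasure = 2 := by
      rw [integral_const_mul, integral_sub_left_eq_self φ torusMeasure t, hφ1, mul_one]
    refine le_trans ?_ h1.le
    refine integral_mono_ae (integrable_mul_comp_sub f hφ t)
      (((hφ.comp (continuous_const.sub continuous_id)).integrable_of_hasCompactSupport
        (HasCompactSupport.of_compactSpace _)).const_mul 2) ?_
    exact hf.mono fun s hs => mul_le_mul_of_nonneg_right hs.2 (hφ0 _)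

theorem stronglyMeasurable_torusConv_integrand (f : TorusLinfty) (hφ : Continuous φ) :
    StronglyMeasurable fun p : Torus × Torus => f p.2 * φ (p.1 - p.2) :=
  ((Lp.stronglyMeasurable f).comp_measurable measurable_snd).mul
    (hφ.comp (continuous_fst.sub continuous_snd)).stronglyMeasurable

theorem fourierCoeff_torusConv (f : TorusLinfty) (hφ : Continuous φ) (n : ℤ) :
    fourierCoeff (fun t => (torusConv f φ t : ℂ)) n =
      torusFourier f n * fourierCoeff (fun t => (φ t : ℂ)) n := by
  have hint : Integrable (fun p : Torus × Torus =>
      fourier (-n) p.1 * ((f p.2 * φ (p.1 - p.2) : ℝ) : ℂ)) (torusMeasure.prod torusMeasure) := by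
    obtain ⟨B, hB⟩ := isCompact_univ.exists_bound_of_continuousOn hφ.continuousOn
    have hf1 : Integrable (fun p : Torus × Torus => f p.2) (torusMeasure.prod torusMeasure) :=
      ((Lp.memLp f).integrable le_top).comp_snd _
    have h1 : Integrable (fun p : Torus × Torus => f p.2 * φ (p.1 - p.2))
        (torusMeasure.prod torusMeasure) :=
      hf1.mul_bdd (c := B) (hφ.comp (continuous_fst.sub continuous_snd)).aestronglyMeasurable
        (Filter.Eventually.of_forall fun p => hB _ (Set.mem_univ _))
    refine h1.ofReal.bdd_mul (c := 1)
      ((fourier (-n)).continuous.comp continuous_fst).aestronglyMeasurable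
      (Filter.Eventually.of_forall fun p => ?_)
    rw [fourier_apply, Circle.norm_coe]
  calc fourierCoeff (fun t => (torusConv f φ t : ℂ)) n
      = ∫ t, ∫ s, fourier (-n) t * ((f s * φ (t - s) : ℝ) : ℂ) ∂torusMeasure ∂torusMeasure := by
        refine integral_congr_ae (Filter.Eventually.of_forall fun t => ?_)
        change fourier (-n) t • ((∫ s, f s * φ (t - s) ∂torusMeasure : ℝ) : ℂ) = _
        rw [← integral_complex_ofReal, smul_eq_mul, ← integral_const_mul]
    _ = ∫ s, ∫ t, fourier (-n) t * ((f s * φ (t - s) : ℝ) : ℂ) ∂torusMeasure ∂torusMeasure :=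
        integral_integral_swap hint
    _ = ∫ s, (fourier (-n) s • (f s : ℂ)) * fourierCoeff (fun t => (φ t : ℂ)) n
          ∂torusMeasure := by
        refine integral_congr_ae (Filter.Eventually.of_forall fun s => ?_)
        change ∫ t, fourier (-n) t * ((f s * φ (t - s) : ℝ) : ℂ) ∂torusMeasure = _
        rw [show fourierCoeff (fun t => (φ t : ℂ)) n =
            ∫ t, fourier (-n) t • (φ t : ℂ) ∂torusMeasure from rfl]
        beta_reduce
        rw [← integral_const_mul, ← integral_add_right_eq_self
            (fun t => fourier (-n) t * ((f s * φ (t - s) : ℝ) : ℂ)) s]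
        refine integral_congr_ae (Filter.Eventually.of_forall fun t => ?_)
        simp only [add_sub_cancel_right, smul_eq_mul, fourier_apply, smul_add,
          AddCircle.toCircle_add, Circle.coe_mul]
        push_cast
        ring
    _ = _ := by
        rw [integral_mul_const]
        rfl

theorem torusConv_eq_zero {E : Set Torus} (hf : ∀ᵐ t ∂torusMeasure, t ∉ E → f t = 0) {δ : ℝ}
    (hφ : ∀ t, δ < ‖t‖ → φ t = 0) {t : Torus} (ht : ∀ s ∈ E, δ < dist t s) :
    torusConv f φ t = 0 := by
  refine integral_eq_zero_of_ae ?_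
  filter_upwards [hf] with s hs
  by_cases hsE : s ∈ E
  · rw [hφ _ (by rw [← dist_eq_norm]; exact ht s hsE), mul_zero]
    rfl
  · rw [hs hsE, zero_mul]
    rfl

end Convolution

/-! ### Density -/

theorem memWeightedL2_of_sum_le {lam : ℕ → ℝ} (hpos : ∀ n, 0 < lam n) {f : TorusLinfty} {B : ℝ}
    (h : ∀ s : Finset ℤ, ∑ n ∈ s, weightedTerm lam f n ≤ B) :
    MemWeightedL2 lam f ∧ weightedNorm lam f ≤ Real.sqrt B := by
  have hs : Summable (weightedTerm lam f) := summable_of_sum_le (weightedTerm_nonneg hpos f) h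
  exact ⟨hs, Real.sqrt_le_sqrt (hs.tsum_le_of_sum_le h)⟩

theorem norm_torusFourier_le {f : TorusLinfty} (hf : ∀ᵐ t ∂torusMeasure, 0 ≤ f t ∧ f t ≤ 2)
    (n : ℤ) : ‖torusFourier f n‖ ≤ 2 := by
  have h := norm_integral_le_of_norm_le_const (μ := torusMeasure) (C := 2)
    (f := fun t => fourier (-n) t • ((f t : ℝ) : ℂ)) (by
      filter_upwards [hf] with t ht
      rw [norm_smul, fourier_apply, Circle.norm_coe, one_mul, Complex.norm_real, Real.norm_eq_abs,
        abs_of_nonneg ht.1]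
      exact ht.2)
  rwa [probReal_univ, mul_one] at h

theorem norm_fourierCoeff_le_one {φ : Torus → ℝ} (hφ0 : ∀ t, 0 ≤ φ t)
    (hφ1 : ∫ t, φ t ∂torusMeasure = 1) (n : ℤ) :
    ‖fourierCoeff (fun t => (φ t : ℂ)) n‖ ≤ 1 := by
  refine (norm_integral_le_integral_norm _).trans (le_of_eq ?_)
  rw [← hφ1]
  refine integral_congr_ae (Filter.Eventually.of_forall fun t => ?_)
  change ‖fourier (-n) t • (φ t : ℂ)‖ = φ t
  rw [norm_smul, fourier_apply, Circle.norm_coe, one_mul, Complex.norm_real, Real.norm_eq_abs,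
    abs_of_nonneg (hφ0 t)]

theorem summable_pow_mul_of_decay {A : ℕ} {c : ℤ → ℂ} {C : ℝ}
    (hC : ∀ k : ℤ, |(k : ℝ)| ^ (A + 2) * ‖c k‖ ≤ C) :
    Summable fun k : ℤ => (1 + |(k : ℝ)|) ^ A * ‖c k‖ := by
  have hs : Summable fun k : ℤ => 2 ^ A * C * (1 / (k : ℝ) ^ 2) :=
    (Real.summable_one_div_int_pow.2 one_lt_two).mul_left _
  refine Summable.of_norm_bounded_eventually hs ?_
  refine (Set.finite_singleton (0 : ℤ)).subset fun k hk => ?_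
  by_contra hk0
  refine hk ?_
  have hk1 : (1 : ℝ) ≤ |(k : ℝ)| := by exact_mod_cast Int.one_le_abs hk0
  change ‖(1 + |(k : ℝ)|) ^ A * ‖c k‖‖ ≤ 2 ^ A * C * (1 / (k : ℝ) ^ 2)
  rw [Real.norm_eq_abs, abs_of_nonneg (by positivity), ← sq_abs (k : ℝ), mul_one_div,
    le_div_iff₀ (by positivity)]
  calc (1 + |(k : ℝ)|) ^ A * ‖c k‖ * |(k : ℝ)| ^ 2
      ≤ (2 * |(k : ℝ)|) ^ A * ‖c k‖ * |(k : ℝ)| ^ 2 := by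
        gcongr
        linarith
    _ = 2 ^ A * (|(k : ℝ)| ^ (A + 2) * ‖c k‖) := by rw [mul_pow, pow_add]; ring
    _ ≤ 2 ^ A * C := by
        gcongr
        exact hC k

theorem hausdorffSum_le_of_subset {E K : TopologicalSpace.NonemptyCompacts Torus} {r : ℝ}
    (hEK : (E : Set Torus) ⊆ K)
    (h : ∀ x ∈ (K : Set Torus), Metric.infDist x (E : Set Torus) ≤ r) :
    hausdorffSum E K ≤ r := by
  rw [hausdorffSum_eq]
  have h1 : hausdorffExcess E K ≤ 0 :=
    hausdorffExcess_le fun x hx => (Metric.infDist_zero_of_mem (hEK hx)).le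
  linarith [hausdorffExcess_le h]

open Filter Topology in
/-- Every pair is a limit of pairs whose function has rapidly decreasing Fourier coefficients:
convolve the function with an approximate identity and thicken the set. -/
theorem exists_smooth_pair_near {lam : ℕ → ℝ} (hpos : ∀ n, 0 < lam n) (A : ℕ)
    (p : SupportPair lam) {ε : ℝ} (hε : 0 < ε) :
    ∃ q : SupportPair lam, pairDist p q < ε ∧
      Summable fun k : ℤ => (1 + |(k : ℝ)|) ^ A * ‖torusFourier q.f k‖ := by
  obtain ⟨φ, hφc, hφ0, hφ1, hφs, hφlim, hφd⟩ := exists_approximate_identity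
  have hbd := fun N => torusConv_bounds p.bounds (hφc N) (hφ0 N) (hφ1 N)
  have hmem : ∀ N, MemLp (torusConv p.f (φ N)) ⊤ torusMeasure := fun N =>
    memLp_top_of_bound
      (stronglyMeasurable_torusConv_integrand p.f (hφc N)).integral_prod_right.aestronglyMeasurable
      2 (Filter.Eventually.of_forall fun t => by
        rw [Real.norm_eq_abs, abs_of_nonneg (hbd N t).1]
        exact (hbd N t).2)
  have hcoeff : ∀ N k, torusFourier ((hmem N).toLp _) k =
      torusFourier p.f k * fourierCoeff (fun t => (φ N t : ℂ)) k := fun N k => by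
    rw [torusFourier_toLp, fourierCoeff_torusConv p.f (hφc N)]
  have hφle := fun N k => norm_fourierCoeff_le_one (hφ0 N) (hφ1 N) k
  have hterm : ∀ N k, weightedTerm lam (p.f - (hmem N).toLp _) k =
      weightedTerm lam p.f k * ‖1 - fourierCoeff (fun t => (φ N t : ℂ)) k‖ ^ 2 := by
    intro N k
    rw [weightedTerm, weightedTerm, torusFourier_sub, hcoeff, ← mul_one_sub, norm_mul, mul_pow]
    ring
  have hnorm : Tendsto (fun N => weightedNorm lam (p.f - (hmem N).toLp _)) atTop (𝓝 0) := by
    have h : Tendsto (fun N => ∑' k, weightedTerm lam (p.f - (hmem N).toLp _) k) atTop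
        (𝓝 (∑' _ : ℤ, 0)) := by
      refine tendsto_tsum_of_dominated_convergence (bound := fun k => weightedTerm lam p.f k * 4)
        (p.mem_weighted.mul_right 4) (fun k => ?_) (Filter.Eventually.of_forall fun N k => ?_)
      · simp_rw [hterm]
        have h1 := (((hφlim k).const_sub 1).norm.pow 2).const_mul (weightedTerm lam p.f k)
        simpa using h1
      · have h0 := weightedTerm_nonneg hpos p.f k
        rw [hterm, Real.norm_eq_abs, abs_of_nonneg (by positivity)]
        have h1 : ‖1 - fourierCoeff (fun t => (φ N t : ℂ)) k‖ ≤ 2 := by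
          refine (norm_sub_le _ _).trans ?_
          rw [norm_one]
          linarith [hφle N k]
        have h2 : ‖1 - fourierCoeff (fun t => (φ N t : ℂ)) k‖ ^ 2 ≤ 2 ^ 2 := by gcongr
        have h3 : (2 : ℝ) ^ 2 = 4 := by norm_num
        rw [h3] at h2
        gcongr
    rw [tsum_zero] at h
    simpa [weightedNorm] using h.sqrt
  have hmemw : ∀ N, MemWeightedL2 lam ((hmem N).toLp _) := by
    intro N
    refine Summable.of_nonneg_of_le (weightedTerm_nonneg hpos _) (fun k => ?_) p.mem_weighted
    have h1 : ‖torusFourier p.f k * fourierCoeff (fun t => (φ N t : ℂ)) k‖ ≤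
        ‖torusFourier p.f k‖ := by
      rw [norm_mul]
      exact mul_le_of_le_one_right (norm_nonneg _) (hφle N k)
    rw [weightedTerm, weightedTerm, hcoeff]
    have := (hpos k.natAbs).le
    gcongr
  obtain ⟨N, hN, hNε⟩ := ((hnorm.eventually (gt_mem_nhds (half_pos hε))).and
    (tendsto_one_div_add_atTop_nhds_zero_nat.eventually (gt_mem_nhds (half_pos hε)))).exists
  have hδ : (0 : ℝ) < 1 / ((N : ℝ) + 1) := by positivity
  obtain ⟨K, hK⟩ : ∃ K : TopologicalSpace.NonemptyCompacts Torus,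
      (K : Set Torus) = Metric.cthickening (1 / ((N : ℝ) + 1)) (p.E : Set Torus) :=
    ⟨⟨⟨_, Metric.isClosed_cthickening.isCompact⟩,
      p.E.nonempty.mono (Metric.self_subset_cthickening _)⟩, rfl⟩
  have hEK : (p.E : Set Torus) ⊆ K := by
    rw [hK]
    exact Metric.self_subset_cthickening _
  have hcthick : ∀ t : Torus, t ∈ (K : Set Torus) ↔
      Metric.infDist t (p.E : Set Torus) ≤ 1 / ((N : ℝ) + 1) := fun t => by
    rw [hK, Metric.cthickening_eq_preimage_infEDist, Set.mem_preimage, Set.mem_Iic,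
      Metric.infDist, ENNReal.le_ofReal_iff_toReal_le (Metric.infEDist_ne_top p.E.nonempty) hδ.le]
  refine ⟨⟨(hmem N).toLp _, K, ?_, ?_, hmemw N⟩, ?_, ?_⟩
  · filter_upwards [(hmem N).coeFn_toLp] with t ht
    rw [ht]
    exact hbd N t
  · rw [essentialSupport_subset_iff _ K.isCompact.isClosed]
    filter_upwards [(hmem N).coeFn_toLp] with t ht htK
    rw [ht]
    refine torusConv_eq_zero
      ((essentialSupport_subset_iff _ p.E.isCompact.isClosed).1 p.support_subset) (hφs N)
      fun s hs => ?_
    rw [hcthick, not_le] at htK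
    exact htK.trans_le (Metric.infDist_le_dist_of_mem hs)
  · have h1 : hausdorffSum p.E K ≤ 1 / ((N : ℝ) + 1) :=
      hausdorffSum_le_of_subset hEK fun x hx => (hcthick x).1 hx
    change hausdorffSum p.E K + weightedNorm lam (p.f - (hmem N).toLp _) < ε
    linarith
  · obtain ⟨C, hC⟩ := hφd N (A + 2)
    refine summable_pow_mul_of_decay (C := 2 * C) fun k => ?_
    · change _ * ‖torusFourier ((hmem N).toLp _) k‖ ≤ _
      rw [hcoeff, norm_mul]
      have h1 := norm_torusFourier_le p.bounds k
      have h2 := hC k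
      calc _ = ‖torusFourier p.f k‖ * (|(k : ℝ)| ^ (A + 2) *
            ‖fourierCoeff (fun t => (φ N t : ℂ)) k‖) := by ring
        _ ≤ 2 * C := by gcongr

theorem nontrivial_torus : Nontrivial Torus := by
  refine ⟨⟨((2 * Real.pi / 2 : ℝ) : Torus), 0, fun h => ?_⟩⟩
  have h1 := AddCircle.norm_half_period_eq (p := 2 * Real.pi)
  rw [h, norm_zero, abs_of_pos Real.two_pi_pos] at h1
  linarith [Real.pi_pos]

/-- The key approximation: a pair can be perturbed slightly so that the set no longer contains a
given open set. The function is first smoothed and then multiplied by `(1 - h) / (1 + δ)`, where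
`h` is a translate of a function provided by `exists_small_cutoff`. -/
theorem exists_pair_near_not_subset {lam : ℕ → ℝ} (hpos : ∀ n, 0 < lam n)
    (hdiv : ¬ Summable (fun n => 1 / lam n))
    (hdoubling : ∃ C : ℝ, 1 < C ∧ ∀ n : ℕ, 1 ≤ n → ∀ k : ℕ, n ≤ k → k ≤ 2 * n →
      C⁻¹ * lam n ≤ lam k ∧ lam k ≤ C * lam n)
    {U : Set Torus} (hU : IsOpen U) (hUne : U.Nonempty) (p₀ : SupportPair lam) {ε : ℝ}
    (hε : 0 < ε) : ∃ q : SupportPair lam, pairDist p₀ q < ε ∧ ¬ U ⊆ (q.E : Set Torus) := by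
  obtain ⟨C, A, hC, hg⟩ := exists_growth_of_doubling hpos hdoubling
  obtain ⟨D, hD, hmod⟩ := exists_moderate_of_growth hpos hC hg
  obtain ⟨p, hpp, hpsum⟩ := exists_smooth_pair_near hpos A p₀ (half_pos hε)
  suffices h : ∃ q : SupportPair lam, pairDist p q < ε / 2 ∧ ¬ U ⊆ (q.E : Set Torus) by
    obtain ⟨q, hq, hqU⟩ := h
    refine ⟨q, ?_, hqU⟩
    have h1 : pairDist p₀ q ≤ pairDist p₀ p + pairDist p q :=
      (pairMetricSpace hpos).dist_triangle p₀ p q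
    linarith
  by_cases hUp : U ⊆ (p.E : Set Torus)
  swap
  · refine ⟨p, ?_, hUp⟩
    have h1 : pairDist p p = 0 := (pairMetricSpace hpos).dist_self p
    linarith
  obtain ⟨x, hxU⟩ := hUne
  obtain ⟨Q, hQ0, hQ⟩ := exists_sum_weighted_convolution_le hpos hD hmod hpsum
  obtain ⟨W, hW⟩ : ∃ W, W = ∑' n, weightedTerm lam p.f n := ⟨_, rfl⟩
  have hW0 : 0 ≤ W := by rw [hW]; exact tsum_nonneg (weightedTerm_nonneg hpos _)
  have hWs : ∀ s : Finset ℤ, ∑ n ∈ s, weightedTerm lam p.f n ≤ W := fun s => by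
    rw [hW]
    exact p.mem_weighted.sum_le_tsum s fun n _ => weightedTerm_nonneg hpos _ _
  -- The parameters are chosen such that `2 δ² W + 2 Q η < (ε / 4)²`.
  obtain ⟨δ, hδ, hδW⟩ : ∃ δ : ℝ, 0 < δ ∧ 2 * δ ^ 2 * W < (ε / 4) ^ 2 / 2 := by
    have hlim : Filter.Tendsto (fun δ : ℝ => 2 * δ ^ 2 * W) (nhdsWithin 0 (Set.Ioi 0))
        (nhds 0) := by
      have h : Continuous fun δ : ℝ => 2 * δ ^ 2 * W := by fun_prop
      simpa using (h.tendsto 0).mono_left nhdsWithin_le_nhds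
    obtain ⟨δ, h1, h2⟩ := ((hlim.eventually (gt_mem_nhds
      (by positivity : 0 < (ε / 4) ^ 2 / 2))).and self_mem_nhdsWithin).exists
    exact ⟨δ, h2, h1⟩
  obtain ⟨η, hη, hηQ⟩ : ∃ η : ℝ, 0 < η ∧ 2 * (Q * η) ≤ (ε / 4) ^ 2 / 2 := by
    refine ⟨(ε / 4) ^ 2 / (4 * (Q + 1)), by positivity, ?_⟩
    have h1 : Q / (Q + 1) ≤ 1 := (div_le_one (by positivity)).2 (by linarith)
    calc 2 * (Q * ((ε / 4) ^ 2 / (4 * (Q + 1)))) = (ε / 4) ^ 2 / 2 * (Q / (Q + 1)) := by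
          field_simp
          ring
      _ ≤ (ε / 4) ^ 2 / 2 * 1 := by gcongr
      _ = _ := mul_one _
  obtain ⟨h, r, hcont, hr, hone, hbd, hsmall⟩ := exists_small_cutoff hpos hdiv hdoubling hδ hη
  have hδ1 : 0 < 1 + δ := by linarith
  have hxcont : Continuous fun t : Torus => h (t - x) :=
    hcont.comp (continuous_id.sub continuous_const)
  have hxmem : MemLp (fun t : Torus => (h (t - x) : ℂ)) 2 torusMeasure :=
    (Complex.continuous_ofReal.comp hxcont).memLp_of_hasCompactSupport
      (HasCompactSupport.of_compactSpace _)
  have hfact : ∀ t, 0 ≤ (1 - h (t - x)) / (1 + δ) ∧ (1 - h (t - x)) / (1 + δ) ≤ 1 := fun t =>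
    ⟨div_nonneg (by linarith [(hbd (t - x)).2]) hδ1.le,
      (div_le_one hδ1).2 (by linarith [(hbd (t - x)).1])⟩
  have hub : ∀ᵐ t ∂torusMeasure, 0 ≤ p.f t * ((1 - h (t - x)) / (1 + δ)) ∧
      p.f t * ((1 - h (t - x)) / (1 + δ)) ≤ 2 := by
    filter_upwards [p.bounds] with t ht
    have h1 := hfact t
    exact ⟨mul_nonneg ht.1 h1.1, (mul_le_of_le_one_right ht.1 h1.2).trans ht.2⟩
  have hmem : MemLp (fun t => p.f t * ((1 - h (t - x)) / (1 + δ))) ⊤ torusMeasure := by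
    refine memLp_top_of_bound ((Lp.aestronglyMeasurable p.f).mul
      ((continuous_const.sub hxcont).div_const _).aestronglyMeasurable) 2 ?_
    filter_upwards [hub] with t ht
    rw [Real.norm_eq_abs, abs_of_nonneg ht.1]
    exact ht.2
  have hprod := fun n => hasSum_fourierCoeff_mul p.f.memLp_two hxmem n
  have hprodsum := hQ _ _ η hη.le hprod (fun s => by
    simp_rw [norm_fourierCoeff_comp_sub (fun t => (h t : ℂ)) x]
    exact hsmall s)
  have hcoeff : ∀ n, torusFourier (p.f - hmem.toLp _) n =
      ((δ / (1 + δ) : ℝ) : ℂ) * torusFourier p.f n +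
        ((1 / (1 + δ) : ℝ) : ℂ) * fourierCoeff (fun t => (p.f t : ℂ) * (h (t - x) : ℂ)) n := by
    intro n
    have hint1 : Integrable (fun t => ((δ / (1 + δ) : ℝ) : ℂ) * (p.f t : ℂ)) torusMeasure :=
      (p.f.memLp_two.integrable (by norm_num)).const_mul _
    have hint2 : Integrable (fun t => ((1 / (1 + δ) : ℝ) : ℂ) *
        ((p.f t : ℂ) * (h (t - x) : ℂ))) torusMeasure :=
      (p.f.memLp_two.integrable_mul hxmem).const_mul _
    rw [torusFourier, torusFourier, ← fourierCoeff.const_mul, ← fourierCoeff.const_mul,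
      ← Pi.add_apply (fourierCoeff _) (fourierCoeff _), ← fourierCoeff.add hint1 hint2]
    refine congrFun (fourierCoeff_congr_ae ?_) n
    filter_upwards [Lp.coeFn_sub p.f (hmem.toLp _), hmem.coeFn_toLp] with t h1 h2
    rw [h1, Pi.sub_apply, h2, Pi.add_apply]
    norm_cast
    field_simp
    ring
  have hdiff : ∀ s : Finset ℤ, ∑ n ∈ s, weightedTerm lam (p.f - hmem.toLp _) n ≤
      2 * δ ^ 2 * W + 2 * (Q * η) := by
    intro s
    have hterm : ∀ n, weightedTerm lam (p.f - hmem.toLp _) n ≤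
        2 * δ ^ 2 * weightedTerm lam p.f n +
          2 * (‖fourierCoeff (fun t => (p.f t : ℂ) * (h (t - x) : ℂ)) n‖ ^ 2 *
            lam n.natAbs) := by
      intro n
      rw [weightedTerm, weightedTerm, hcoeff]
      obtain ⟨a, ha⟩ : ∃ a, a = ‖torusFourier p.f n‖ := ⟨_, rfl⟩
      obtain ⟨b, hb⟩ : ∃ b, b =
        ‖fourierCoeff (fun t => (p.f t : ℂ) * (h (t - x) : ℂ)) n‖ := ⟨_, rfl⟩
      have ha0 : 0 ≤ a := ha ▸ norm_nonneg _
      have hb0 : 0 ≤ b := hb ▸ norm_nonneg _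
      have h1 : ‖((δ / (1 + δ) : ℝ) : ℂ) * torusFourier p.f n +
          ((1 / (1 + δ) : ℝ) : ℂ) * fourierCoeff (fun t => (p.f t : ℂ) * (h (t - x) : ℂ)) n‖ ≤
          δ * a + b := by
        refine (norm_add_le _ _).trans ?_
        rw [norm_mul, norm_mul, Complex.norm_real, Complex.norm_real, Real.norm_eq_abs,
          Real.norm_eq_abs, abs_of_pos (by positivity), abs_of_pos (by positivity), ← ha, ← hb]
        refine add_le_add ?_ ?_
        · gcongr
          exact div_le_self hδ.le (by linarith)
        · refine mul_le_of_le_one_left hb0 ((div_le_one hδ1).2 (by linarith))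
      have h2 : (δ * a + b) ^ 2 ≤ 2 * δ ^ 2 * a ^ 2 + 2 * b ^ 2 := by
        nlinarith [sq_nonneg (δ * a - b)]
      rw [← ha, ← hb]
      have h3 := (hpos n.natAbs).le
      calc _ ≤ (δ * a + b) ^ 2 * lam n.natAbs := by gcongr
        _ ≤ (2 * δ ^ 2 * a ^ 2 + 2 * b ^ 2) * lam n.natAbs := by gcongr
        _ = _ := by ring
    refine (Finset.sum_le_sum fun n _ => hterm n).trans ?_
    rw [Finset.sum_add_distrib, ← Finset.mul_sum, ← Finset.mul_sum]
    have h1 := hWs s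
    have h2 := hprodsum s
    gcongr
  obtain ⟨hdmem, hdnorm⟩ := memWeightedL2_of_sum_le hpos hdiff
  have hgmem : MemWeightedL2 lam (hmem.toLp _) := by
    have h1 := p.mem_weighted.sub hpos hdmem
    rwa [sub_sub_cancel] at h1
  obtain ⟨ρ, hρ, hρr, hρε⟩ : ∃ ρ : ℝ, 0 < ρ ∧ ρ ≤ r ∧ ρ ≤ ε / 4 :=
    ⟨min r (ε / 4), by positivity, min_le_left _ _, min_le_right _ _⟩
  have hxE : x ∈ (p.E : Set Torus) := hUp hxU
  obtain ⟨K, hK⟩ : ∃ K : TopologicalSpace.NonemptyCompacts Torus,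
      (K : Set Torus) = insert x ((p.E : Set Torus) \ Metric.ball x ρ) :=
    ⟨⟨⟨_, (p.E.isCompact.diff Metric.isOpen_ball).insert x⟩, Set.insert_nonempty _ _⟩, rfl⟩
  refine ⟨⟨hmem.toLp _, K, ?_, ?_, hgmem⟩, ?_, ?_⟩
  · filter_upwards [hub, hmem.coeFn_toLp] with t h1 h2
    rw [h2]
    exact h1
  · rw [essentialSupport_subset_iff _ K.isCompact.isClosed]
    filter_upwards [hmem.coeFn_toLp,
      (essentialSupport_subset_iff _ p.E.isCompact.isClosed).1 p.support_subset] with t h1 h2 htK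
    rw [h1]
    by_cases htE : t ∈ (p.E : Set Torus)
    · have htb : t ∈ Metric.ball x ρ := by
        by_contra htb
        exact htK (hK ▸ Set.mem_insert_of_mem _ ⟨htE, htb⟩)
      rw [Metric.mem_ball, dist_eq_norm] at htb
      rw [hone _ (htb.le.trans hρr), sub_self, zero_div, mul_zero]
    · rw [h2 htE, zero_mul]
  · have hKE : (K : Set Torus) ⊆ p.E := by
      rw [hK]
      exact Set.insert_subset hxE Set.sdiff_subset
    have h1 : hausdorffSum p.E K ≤ ε / 4 := by
      rw [hausdorffSum_comm]
      refine hausdorffSum_le_of_subset hKE fun y hy => ?_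
      by_cases hyb : y ∈ Metric.ball x ρ
      · have hxK : x ∈ (K : Set Torus) := hK ▸ Set.mem_insert _ _
        refine (Metric.infDist_le_dist_of_mem hxK).trans ?_
        exact (Metric.mem_ball.1 hyb).le.trans hρε
      · rw [Metric.infDist_zero_of_mem (hK ▸ Set.mem_insert_of_mem _ ⟨hy, hyb⟩)]
        positivity
    have h2 : weightedNorm lam (p.f - hmem.toLp _) < ε / 4 := by
      refine hdnorm.trans_lt ?_
      rw [Real.sqrt_lt' (by positivity)]
      linarith
    change hausdorffSum p.E K + weightedNorm lam (p.f - hmem.toLp _) < ε / 2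
    linarith
  · -- The circle has no isolated points, so `U` contains points near `x` other than `x`.
    intro hUK
    have := nontrivial_torus
    have hnb : (nhdsWithin x {x}ᶜ).NeBot := inferInstance
    have hev : ∀ᶠ y in nhdsWithin x {x}ᶜ, y ∈ ({x}ᶜ : Set Torus) ∧ y ∈ U ∧
        y ∈ Metric.ball x ρ := by
      filter_upwards [self_mem_nhdsWithin, nhdsWithin_le_nhds (hU.mem_nhds hxU),
        nhdsWithin_le_nhds (Metric.ball_mem_nhds x hρ)] with y h1 h2 h3 using ⟨h1, h2, h3⟩
    obtain ⟨y, hyx, hyU, hyb⟩ := hev.exists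
    have hyK : y ∈ (K : Set Torus) := hUK hyU
    rw [hK] at hyK
    rcases hyK with hyK | hyK
    · exact hyx hyK
    · exact hyK.2 hyb

end

theorem mainTheorem1 (lam : ℕ → ℝ) (hpos : ∀ n, 0 < lam n)
    (hdiv : ¬ Summable (fun n => 1 / lam n))
    (hdoubling : ∃ C : ℝ, 1 < C ∧ ∀ n : ℕ, 1 ≤ n → ∀ k : ℕ, n ≤ k → k ≤ 2 * n →
      C⁻¹ * lam n ≤ lam k ∧ lam k ≤ C * lam n) :
    ∃ _m : MetricSpace (SupportPair lam),
      (∀ p q : SupportPair lam, dist p q = pairDist p q) ∧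
      CompleteSpace (SupportPair lam) ∧
      IsGδ {p : SupportPair lam | interior (p.E : Set Torus) = ∅} ∧
      Dense {p : SupportPair lam | interior (p.E : Set Torus) = ∅} := by
  obtain ⟨hGδ, hdense⟩ := isGδ_and_dense_of_forall_exists hpos fun U hU hUne p ε hε =>
    exists_pair_near_not_subset hpos hdiv hdoubling hU hUne p hε
  exact ⟨pairMetricSpace hpos, fun _ _ => rfl, completeSpace_supportPair hpos, hGδ, hdense⟩
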